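/- \textbf{Setting.} Let $\mathcal H=L^2(\mathbb R)$ be the space of wavefunctions $\psi(q)=\langle q|\psi\rangle$ of one mode with bosonic operators $a,a^\dagger$, in the representation of the quadrature $X=(a+a^\dagger)/2$. For $x,r\in\mathbb R$ let $U_{x,r}=D(x)S(r)$, with $D(x)=e^{x(a^\dagger-a)}$ and $S(r)=e^{\frac r2(a^{\dagger2}-a^2)}$, that is, $$(U_{x,r}\psi)(q)=e^{-r/2}\,\psi\big(e^{-r}(q-x)\big);$$ this is a unitary representation of the affine group with law $(x,r)(x',r')=(x+e^{r}x',\,r+r')$ and left-invariant measure $d_Lg=e^{-r}\,dr\,dx$. Let $|y\rangle$, $\langle q|y\rangle=\pi^{-1/2}e^{2iqy}$, be the Dirac-normalized eigenvectors of $Y=(a-a^\dagger)/(2i)$. On the two-mode space $\mathcal H\otimes\mathcal H=L^2(\mathbb R^2)$, where the second (reference) mode serves as multiplicity space, consider $U_{x,r}\otimes 1$ and the generalized vectors $$|\Phi_\pm\rangle\!\rangle=\frac1{\sqrt\pi}\int_{-\infty}^{\infty}dy\,\sqrt{|y|}\;|y\rangle|\pm y\rangle ,$$ understood as forms on Schwartz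 functions: $\langle\!\langle\Phi_s|\Psi\rangle\!\rangle=\pi^{-1/2}\int dy\,\sqrt{|y|}\,\tilde\Psi(y,sy)$ with $\tilde\Psi(y,y')=\langle y|\langle y'|\Psi\rangle$. Put, as a sesquilinear form on Schwartz functions, $$M(g)=(U_{x,r}\otimes1)\Big(\sum_{s=\pm}|\Phi_s\rangle\!\rangle\langle\!\langle\Phi_s|\Big)(U_{x,r}^\dagger\otimes1),\qquad g=(x,r).$$ A test function is a function in $C_c^\infty(\mathbb R^2)$ of $(x,r)$. \textbf{Statement.} (1) (Orthogonality relation.) As distributions in $(x,r)$, $\langle\!\langle\Phi_s|\,U_{x,r}\otimes1\,|\Phi_{s'}\rangle\!\rangle=\delta(x)\,\delta(r)\,\delta_{ss'}$. That is, for every test function $f$ the generalized vector $\int dx\,dr\,f(x,r)\,U_{x,r}\otimes1|\Phi_{s'}\rangle\!\rangle$ has a $Y$-representation wavefunction $\kappa\in L^2(\mathbb R^2)$ that is continuous off the coordinate axes, the function $y\mapsto\sqrt{|y|}\,\kappa(y,sy)$ is integrable, and $\pi^{-1/2}\int dy\sqrt{|y|}\,\kappa(y,sy)=f(0,0)\,\delta_{ss'}$.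 (2) For every test function $f$ and sign $s$ there is exactly one vector $|f,s\rangle\!\rangle\in L^2(\mathbb R^2)$ with $|f,s\rangle\!\rangle=\int d_Lg\,f(g)\,U_g\otimes1|\Phi_s\rangle\!\rangle$ as forms on Schwartz functions. (3) There are bounded operators $E(B)$, uniquely determined for Borel $B\subseteq\mathbb R^2$, with $\langle\Psi|E(B)|\Psi'\rangle=\int_B d_Lg\,\langle\Psi|M(g)|\Psi'\rangle$ (absolutely convergent) for all Schwartz functions $\Psi,\Psi'$. They form a normalized POVM ($E(B)\ge0$, $E(\mathbb R^2)=\int d_Lg\,M(g)=1$, countable additivity) that is covariant, $(U_g\otimes1)E(B)(U_g^\dagger\otimes1)=E(gB)$, and orthogonal, that is, a von Neumann observable: every $E(B)$ is an orthogonal projection and $E(B)E(C)=E(B\cap C)$. (4) For all test functions $f,f'$, signs $s,s'$ and Borel sets $B$, $\langle\!\langle f,s|E(B)|f',s'\rangle\!\rangle=\delta_{ss'}\int_B d_Lg\,\overline{f(g)}f'(g)$. (5) (Perfect joint estimation.) For every open neighbourhood $N$ of $(0,0)$ and each sign $s$ there is a test function $f$ supported in $N$ such that $v=|f,s\rangle\!\rangle$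 has norm $1$ and, for every $g=(x,r)$, measuring $E$ in the state $(U_g\otimes1)v$ gives an outcome in $gN$ with probability $1$. -/

import Mathlib

open MeasureTheory Set Filter Topology
open scoped SchwartzMap ContDiff ComplexConjugate InnerProductSpace

noncomputable section

namespace AffineEstimation

/-! ### The affine group

The element `(x, r)` stands for the transformation `q ↦ e ^ r * q + x` of the real line. -/

/-- Composition of affine transformations. -/
def affMul (g h : ℝ × ℝ) : ℝ × ℝ := (g.1 + Real.exp g.2 * h.1, g.2 + h.2)

/-- Inverse affine transformation. -/
def affInv (g : ℝ × ℝ) : ℝ × ℝ := (-(Real.exp (-g.2) * g.1), -g.2)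

/-- The left-invariant measure `e ^ (-r) dr dx` on the affine group. -/
def haarL : Measure (ℝ × ℝ) :=
  (volume : Measure (ℝ × ℝ)).withDensity fun g => ENNReal.ofReal (Real.exp (-g.2))

/-! ### Squeezing and displacement on wavefunctions in the `X`-representation -/

/-- The displacement `D(x) = exp (x (a† - a)) = exp (-x d/dq)`. -/
def displace (x : ℝ) (ψ : ℝ → ℂ) : ℝ → ℂ := fun q => ψ (q - x)

/-- The squeezing `S(r) = exp ((r/2) (a†² - a²)) = exp (-r (q d/dq + 1/2))`. -/
def squeeze (r : ℝ) (ψ : ℝ → ℂ) : ℝ → ℂ :=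
  fun q => (Real.exp (-r / 2) : ℂ) * ψ (Real.exp (-r) * q)

/-- `U_{x,r} = D(x) S(r)`. -/
def affAct (g : ℝ × ℝ) (ψ : ℝ → ℂ) : ℝ → ℂ := displace g.1 (squeeze g.2 ψ)

/-- `U_{x,r} ⊗ 1` on wavefunctions of two modes: `U_{x,r}` acts on the first variable, the second
variable (the reference mode) is a parameter. -/
def affAct₂ (g : ℝ × ℝ) (Ψ : ℝ × ℝ → ℂ) : ℝ × ℝ → ℂ :=
  fun q => affAct g (fun q₁ => Ψ (q₁, q.2)) q.1

/-- The two-mode Hilbert space `L²(ℝ) ⊗ L²(ℝ) = L²(ℝ²)`, in the `X`-representation. -/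
abbrev TwoMode : Type := Lp ℂ 2 (volume : Measure (ℝ × ℝ))

/-- The affine map of the first variable which appears in `affAct₂`. -/
def affShift (g q : ℝ × ℝ) : ℝ × ℝ := (Real.exp (-g.2) * (q.1 - g.1), q.2)

theorem affAct₂_apply (g : ℝ × ℝ) (Ψ : ℝ × ℝ → ℂ) (q : ℝ × ℝ) :
    affAct₂ g Ψ q = (Real.exp (-g.2 / 2) : ℂ) * Ψ (affShift g q) := rfl

theorem affShift_affInv (g q : ℝ × ℝ) : affShift (affInv g) (affShift g q) = q := by
  have h : Real.exp g.2 * Real.exp (-g.2) = 1 := by rw [← Real.exp_add]; simp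
  ext
  · simp only [affShift, affInv, neg_neg, sub_neg_eq_add]
    linear_combination (q.1) * h
  · rfl

theorem affInv_affInv (g : ℝ × ℝ) : affInv (affInv g) = g := by
  have h : Real.exp g.2 * Real.exp (-g.2) = 1 := by rw [← Real.exp_add]; simp
  ext
  · simp only [affInv, neg_neg]
    linear_combination g.1 * h
  · simp [affInv]

theorem affAct₂_affInv (g : ℝ × ℝ) (Ψ : ℝ × ℝ → ℂ) : affAct₂ (affInv g) (affAct₂ g Ψ) = Ψ := by
  funext q
  have h := affShift_affInv (affInv g) q
  rw [affInv_affInv] at h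
  rw [affAct₂_apply, affAct₂_apply, h, ← mul_assoc, ← Complex.ofReal_mul, ← Real.exp_add]
  simp [affInv, neg_div]

theorem measurable_affShift (g : ℝ × ℝ) : Measurable (affShift g) := by
  unfold affShift; fun_prop

theorem map_affShift (g : ℝ × ℝ) :
    Measure.map (affShift g) (volume : Measure (ℝ × ℝ)) =
      ENNReal.ofReal (Real.exp g.2) • (volume : Measure (ℝ × ℝ)) := by
  have e : affShift g = Prod.map (fun t : ℝ => Real.exp (-g.2) * (t - g.1)) id := rfl
  have h1 : Measure.map (fun t : ℝ => Real.exp (-g.2) * (t - g.1)) volume =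
      ENNReal.ofReal (Real.exp g.2) • (volume : Measure ℝ) := by
    have : (fun t : ℝ => Real.exp (-g.2) * (t - g.1)) =
        (fun t : ℝ => Real.exp (-g.2) * t) ∘ (fun t : ℝ => t - g.1) := rfl
    rw [this, ← Measure.map_map (by fun_prop) (by fun_prop),
      (measurePreserving_sub_right volume g.1).map_eq,
      Real.map_volume_mul_left (Real.exp_ne_zero _), ← Real.exp_neg, neg_neg,
      abs_of_pos (Real.exp_pos _)]
  rw [e, Measure.volume_eq_prod, ← Measure.map_prod_map _ _ (by fun_prop) measurable_id, h1,
    Measure.map_id, Measure.prod_smul_left]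

theorem quasiMeasurePreserving_affShift (g : ℝ × ℝ) :
    Measure.QuasiMeasurePreserving (affShift g) (volume : Measure (ℝ × ℝ)) volume :=
  ⟨measurable_affShift g, by
    rw [map_affShift]; exact Measure.smul_absolutelyContinuous⟩

theorem affAct₂_congr (g : ℝ × ℝ) {Ψ Ψ' : ℝ × ℝ → ℂ} (h : Ψ =ᵐ[volume] Ψ') :
    affAct₂ g Ψ =ᵐ[volume] affAct₂ g Ψ' := by
  filter_upwards [(quasiMeasurePreserving_affShift g).ae_eq_comp h] with q hq
  rw [affAct₂_apply, affAct₂_apply]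
  exact congrArg _ hq

theorem eLpNorm_affAct₂ (g : ℝ × ℝ) {Ψ : ℝ × ℝ → ℂ} (h : AEStronglyMeasurable Ψ volume) :
    eLpNorm (affAct₂ g Ψ) 2 volume = eLpNorm Ψ 2 volume := by
  have e : affAct₂ g Ψ = (Real.exp (-g.2 / 2) : ℂ) • (Ψ ∘ affShift g) := rfl
  have h' : AEStronglyMeasurable Ψ (Measure.map (affShift g) volume) := by
    rw [map_affShift]; exact h.smul_measure _
  rw [e, eLpNorm_const_smul, ← eLpNorm_map_measure h' (measurable_affShift g).aemeasurable,
    map_affShift, eLpNorm_smul_measure_of_ne_top (by norm_num), smul_eq_mul, ← mul_assoc]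
  have h2 : ‖(Real.exp (-g.2 / 2) : ℂ)‖ₑ *
      ENNReal.ofReal (Real.exp g.2) ^ (1 / (2 : ENNReal)).toReal = 1 := by
    rw [← ofReal_norm, Complex.norm_real, Real.norm_of_nonneg (Real.exp_pos _).le,
      ENNReal.ofReal_rpow_of_pos (Real.exp_pos _), ← ENNReal.ofReal_mul (Real.exp_pos _).le,
      ← Real.exp_mul, ← Real.exp_add]
    have : -g.2 / 2 + g.2 * (1 / (2 : ENNReal)).toReal = 0 := by
      simp; ring
    rw [this]; simp
  rw [h2, one_mul]

theorem memLp_affAct₂ (g : ℝ × ℝ) {Ψ : ℝ × ℝ → ℂ} (h : MemLp Ψ 2 volume) :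
    MemLp (affAct₂ g Ψ) 2 volume := by
  refine ⟨?_, by rw [eLpNorm_affAct₂ g h.1]; exact h.2⟩
  exact (h.1.comp_quasiMeasurePreserving (quasiMeasurePreserving_affShift g)).const_smul
    (Real.exp (-g.2 / 2) : ℂ)

/-- `U_{x,r} ⊗ 1` on the two-mode Hilbert space, as a linear map. -/
def affLin (g : ℝ × ℝ) : TwoMode →ₗ[ℂ] TwoMode where
  toFun Ψ := (memLp_affAct₂ g (Lp.memLp Ψ)).toLp (affAct₂ g Ψ)
  map_add' Ψ Ψ' := by
    rw [← MemLp.toLp_add, MemLp.toLp_eq_toLp_iff]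
    refine (affAct₂_congr g (Lp.coeFn_add Ψ Ψ')).trans (Eventually.of_forall fun q => ?_)
    simp only [affAct₂_apply, Pi.add_apply]; ring
  map_smul' c Ψ := by
    rw [RingHom.id_apply, ← MemLp.toLp_const_smul, MemLp.toLp_eq_toLp_iff]
    refine (affAct₂_congr g (Lp.coeFn_smul c Ψ)).trans (Eventually.of_forall fun q => ?_)
    simp only [affAct₂_apply, Pi.smul_apply, smul_eq_mul]; ring

theorem affLin_affInv (g : ℝ × ℝ) (Ψ : TwoMode) : affLin (affInv g) (affLin g Ψ) = Ψ := by
  apply Lp.ext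
  have h1 := MemLp.coeFn_toLp (memLp_affAct₂ (affInv g) (Lp.memLp (affLin g Ψ)))
  have h2 := affAct₂_congr (affInv g) (MemLp.coeFn_toLp (memLp_affAct₂ g (Lp.memLp Ψ)))
  rw [affAct₂_affInv] at h2
  exact h1.trans h2

/-- The unitary operator `U_{x,r} ⊗ 1` on the two-mode Hilbert space. -/
def affU (g : ℝ × ℝ) : TwoMode ≃ₗᵢ[ℂ] TwoMode where
  toLinearEquiv := LinearEquiv.ofLinearMap (affLin g) (affLin (affInv g))
    (LinearMap.ext fun Ψ => by
      have h := affLin_affInv (affInv g) Ψ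
      rwa [affInv_affInv] at h)
    (LinearMap.ext fun Ψ => affLin_affInv g Ψ)
  norm_map' Ψ := by
    change ‖(memLp_affAct₂ g (Lp.memLp Ψ)).toLp (affAct₂ g Ψ)‖ = ‖Ψ‖
    rw [Lp.norm_toLp, eLpNorm_affAct₂ g (Lp.memLp Ψ).1, Lp.norm_def]

/-! ### Eigenstates of the quadrature `Y` and the generalized vectors `Φ_±` -/

/-- `⟨q|y⟩`: the Dirac-normalized eigenfunction, with eigenvalue `y`, of the quadrature
`Y = (a - a†) / (2 i) = -(i/2) d/dq`, in the `X`-representation. -/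
def eigY (y q : ℝ) : ℂ := ((√Real.pi)⁻¹ : ℝ) * Complex.exp (2 * Complex.I * q * y)

/-- The amplitude `(⟨y| ⊗ ⟨y'|) Ψ`, that is, the two-mode wavefunction in the `Y`-representation
(for an integrable `Ψ`; it is used for Schwartz functions). -/
def yWave (Ψ : ℝ × ℝ → ℂ) (p : ℝ × ℝ) : ℂ :=
  ∫ q : ℝ × ℝ, conj (eigY p.1 q.1 * eigY p.2 q.2) * Ψ q

/-- The pairing of `|Φ_s⟩⟩ = π^{-1/2} ∫ dy √|y| |y⟩|s y⟩`, `s = ±1`, with a wavefunction `κ` in the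
`Y`-representation: `π^{-1/2} ∫ dy √|y| κ(y, s y)`. -/
def pointerY (s : ℤˣ) (κ : ℝ × ℝ → ℂ) : ℂ :=
  ((√Real.pi)⁻¹ : ℝ) * ∫ y : ℝ, (√|y| : ℂ) * κ (y, ((s : ℤ) : ℝ) * y)

/-- The amplitude `⟨⟨Φ_s| U_{x,r}† ⊗ 1 |Ψ⟩⟩` for a Schwartz function `Ψ`. -/
def amp (s : ℤˣ) (g : ℝ × ℝ) (Ψ : 𝓢(ℝ × ℝ, ℂ)) : ℂ :=
  pointerY s (yWave (affAct₂ (affInv g) Ψ))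

/-- The POVM density
`⟨⟨Ψ| (U_{x,r} ⊗ 1) (∑ s, |Φ_s⟩⟩⟨⟨Φ_s|) (U_{x,r}† ⊗ 1) |Ψ'⟩⟩`, as a form on Schwartz functions. -/
def povmDensity (g : ℝ × ℝ) (Ψ Ψ' : 𝓢(ℝ × ℝ, ℂ)) : ℂ :=
  ∑ s : ℤˣ, conj (amp s g Ψ) * amp s g Ψ'

/-- `Ψ` as an element of the two-mode Hilbert space. -/
abbrev toTwoMode (Ψ : 𝓢(ℝ × ℝ, ℂ)) : TwoMode := Ψ.toLp 2 volume

/-! ### Operator-valued measures -/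

/-- Normalized positive-operator-valued measures, with outcomes in `G`. -/
structure IsPOVM {G : Type*} [MeasurableSpace G] {H : Type*} [NormedAddCommGroup H]
    [InnerProductSpace ℂ H] [CompleteSpace H] (E : Set G → H →L[ℂ] H) : Prop where
  isPositive : ∀ B, MeasurableSet B → (E B).IsPositive
  normalized : E univ = 1
  hasSum : ∀ B : ℕ → Set G, (∀ n, MeasurableSet (B n)) → Pairwise (Function.onFun Disjoint B) →
    ∀ v : H, HasSum (fun n => E (B n) v) (E (⋃ n, B n) v)

/-- Orthogonal POVMs (von Neumann observables): projection-valued measures. -/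
structure IsOrthogonalPOVM {G : Type*} [MeasurableSpace G] {H : Type*} [NormedAddCommGroup H]
    [InnerProductSpace ℂ H] [CompleteSpace H] (E : Set G → H →L[ℂ] H) : Prop
    extends IsPOVM E where
  isStarProjection : ∀ B, MeasurableSet B → IsStarProjection (E B)
  mul_eq : ∀ B C, MeasurableSet B → MeasurableSet C → E B * E C = E (B ∩ C)

/-- Covariance: `U_g E(B) U_g† = E(g B)`. -/
def IsCovariant (E : Set (ℝ × ℝ) → TwoMode →L[ℂ] TwoMode) : Prop :=
  ∀ g B, MeasurableSet B → ∀ v : TwoMode,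
    affU g (E B ((affU g).symm v)) = E (affMul g '' B) v

/-- `E(B) = ∫_B d_L g M(g)`, with the density `M(g)` of `povmDensity`: the matrix elements between
Schwartz functions agree, the integrals being absolutely convergent. -/
def IsGenerated (E : Set (ℝ × ℝ) → TwoMode →L[ℂ] TwoMode) : Prop :=
  ∀ B, MeasurableSet B → ∀ Ψ Ψ' : 𝓢(ℝ × ℝ, ℂ),
    IntegrableOn (fun g => povmDensity g Ψ Ψ') B haarL ∧
    ⟪toTwoMode Ψ, E B (toTwoMode Ψ')⟫_ℂ = ∫ g in B, povmDensity g Ψ Ψ' ∂haarL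

/-! ### Superpositions of the vectors `U_{x,r} ⊗ 1 |Φ_s⟩⟩` -/

/-- Test functions in the parameters `(x, r)`. -/
structure IsTest (f : ℝ × ℝ → ℂ) : Prop where
  contDiff : ContDiff ℝ ∞ f
  compact : HasCompactSupport f

/-- The superposition `∫ μ(dg) f(g) U_g ⊗ 1 |Φ_s⟩⟩` as an antilinear form on Schwartz functions:
`Ψ ↦ ∫ μ(dg) f(g) ⟨⟨Ψ| U_g ⊗ 1 |Φ_s⟩⟩`. -/
def packet (μ : Measure (ℝ × ℝ)) (f : ℝ × ℝ → ℂ) (s : ℤˣ) (Ψ : 𝓢(ℝ × ℝ, ℂ)) : ℂ :=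
  ∫ g, f g * conj (amp s g Ψ) ∂μ

/-- The vector `v` of the two-mode Hilbert space is the superposition
`∫ d_L g f(g) U_g ⊗ 1 |Φ_s⟩⟩`. -/
def IsPacket (f : ℝ × ℝ → ℂ) (s : ℤˣ) (v : TwoMode) : Prop :=
  ∀ Ψ : 𝓢(ℝ × ℝ, ℂ), ⟪toTwoMode Ψ, v⟫_ℂ = packet haarL f s Ψ

/-- `⟨⟨Φ_s|T⟩⟩ = c` for a generalized two-mode vector `T` (an antilinear form on Schwartz
functions) which is given in the `Y`-representation by a square-integrable wavefunction `κ` that is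
continuous off the coordinate axes. These values of `κ` are determined by `T`, and the line
`{(y, s y)}` meets the axes only in the origin. -/
def HasPointerValue (s : ℤˣ) (T : 𝓢(ℝ × ℝ, ℂ) → ℂ) (c : ℂ) : Prop :=
  ∃ κ : ℝ × ℝ → ℂ, MemLp κ 2 volume ∧ ContinuousOn κ {p | p.1 * p.2 ≠ 0} ∧
    (∀ Ψ : 𝓢(ℝ × ℝ, ℂ), T Ψ = ∫ p, conj (yWave Ψ p) * κ p) ∧
    Integrable (fun y : ℝ => (√|y| : ℂ) * κ (y, ((s : ℤ) : ℝ) * y)) ∧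
    pointerY s κ = c

end AffineEstimation

end

open MeasureTheory Set Filter Topology
open scoped SchwartzMap ContDiff ComplexConjugate InnerProductSpace

/-! In the `Y`-representation a displacement is a phase and a squeezing is a dilation, so `U_g ⊗ 1`
carries the line `y' = s y` through the lines `y' = s e^r y`. In the coordinates `(u, r) ↦ (u, s e^r
u)`, which parametrize the quadrants `s y y' > 0` up to a null set with Jacobian `e^r |u|`, the
amplitude `⟨⟨Φ_s|U_g† ⊗ 1|Ψ⟩⟩` is `e^r` times the Fourier transform, from `u` to `x`, of `√|u|`
times the wavefunction (`amp_eq`). The weight `√|y|` in `Φ_s` and the factor `e^{-r}` in the Haar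
measure reproduce exactly this Jacobian, so Plancherel gives an isometry from `L²` of the quadrants
to `L²` of the group (`lintegral_amp`). The two signs tile the plane.

Conversely, a test function `f` comes from the explicit wavefunction `packetWave f s`, whose norm is
that of `f` (`lintegral_packetWave`, `packet_haarL`). Hence the adjoints of the amplitude operators
are isometric, and the pair of amplitudes is a unitary map onto two copies of `L²` of the group
(`sum_adjoint_comp_ampOp`, `ampOp_adjoint`). The observable is multiplication by indicator functions
transported by this unitary, which makes it projection-valued; packets correspond to the functions
`f` themselves, so a packet supported near the identity is detected there with certainty. Covariance
follows from left invariance and the uniqueness of the operators with a given density.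

The distributional orthogonality relation is the restriction of `packetWave` to `r = 0`, which
yields `δ(r)`, followed by Fourier inversion at `0`, which yields `δ(x)`. -/

namespace AffineEstimation

/-! ### Plancherel for Fourier integrals of functions in `L¹ ∩ L²`. -/

section Plancherel

open FourierTransform

variable {V : Type*} [NormedAddCommGroup V] [InnerProductSpace ℝ V] [FiniteDimensional ℝ V]
  [MeasurableSpace V] [BorelSpace V]

/-- The Fourier transform of `L²` is given by the Fourier integral on `L¹ ∩ L²`. -/
theorem fourier_toLp_ae_eq {h : V → ℂ} (h1 : Integrable h) (h2 : MemLp h 2) :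
    (𝓕 (h2.toLp h) : Lp ℂ 2 (volume : Measure V)) =ᵐ[volume] 𝓕 h := by
  have hc : Continuous (𝓕 h) :=
    VectorFourier.fourierIntegral_continuous Real.continuous_fourierChar continuous_inner h1
  refine ae_eq_of_integral_contDiff_smul_eq ((Lp.memLp _).locallyIntegrable (by norm_num))
    hc.locallyIntegrable fun g hg hgs => ?_
  have hgc : ContDiff ℝ ∞ fun x => (g x : ℂ) := Complex.ofRealCLM.contDiff.comp hg
  have hgcs : HasCompactSupport fun x => (g x : ℂ) := hgs.comp_left Complex.ofReal_zero
  set G : 𝓢(V, ℂ) := hgcs.toSchwartzMap hgc with hG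
  have hGa : ∀ x, G x = (g x : ℂ) := fun x => rfl
  have e1 : ∫ x, g x • (𝓕 (h2.toLp h) : Lp ℂ 2 (volume : Measure V)) x
      = ⟪G.toLp 2 volume, 𝓕 (h2.toLp h)⟫_ℂ := by
    rw [L2.inner_def]
    refine integral_congr_ae ?_
    filter_upwards [G.coeFn_toLp 2 volume] with x hx
    rw [hx, hGa, RCLike.inner_apply, Complex.conj_ofReal, Complex.real_smul, mul_comm]
  -- Writing the test function as a Fourier transform lets Plancherel move the transform off `h`;
  -- since `G` is real, conjugating `𝓕⁻ G` gives `𝓕 G`, and the multiplication formula finishes.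
  have e2 : G = 𝓕 (𝓕⁻ G) := (FourierTransform.fourier_fourierInv_eq G).symm
  have e3 : ⟪G.toLp 2 volume, 𝓕 (h2.toLp h)⟫_ℂ = ⟪(𝓕⁻ G).toLp 2 volume, h2.toLp h⟫_ℂ := by
    conv_lhs => rw [e2, ← SchwartzMap.toLp_fourier_eq]
    exact Lp.inner_fourier_eq _ _
  have e4 : ⟪(𝓕⁻ G).toLp 2 volume, h2.toLp h⟫_ℂ = ∫ x, (starRingEnd ℂ) ((𝓕⁻ G) x) * h x := by
    rw [L2.inner_def]
    refine integral_congr_ae ?_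
    filter_upwards [(𝓕⁻ G).coeFn_toLp 2 volume, h2.coeFn_toLp] with x hx hx'
    rw [hx, hx', RCLike.inner_apply, mul_comm]
  have e5 : ∀ x, (starRingEnd ℂ) ((𝓕⁻ G) x) = (𝓕 G) x := by
    intro x
    rw [SchwartzMap.fourierInv_coe, SchwartzMap.fourier_coe, Real.fourier_eq', Real.fourierInv_eq',
      ← integral_conj]
    refine integral_congr_ae (Eventually.of_forall fun y => ?_)
    simp only [smul_eq_mul, map_mul, ← Complex.exp_conj, Complex.conj_ofReal, Complex.conj_I, hGa]
    congr 2
    push_cast; ring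
  have e6 := VectorFourier.integral_fourierIntegral_smul_eq_flip (L := innerₗ V)
    Real.continuous_fourierChar continuous_inner G.integrable h1 (μ := volume) (ν := volume)
  rw [e1, e3, e4]
  simp_rw [e5]
  rw [flip_innerₗ] at e6
  simpa [SchwartzMap.fourier_coe, hGa] using! e6

theorem eLpNorm_fourier_eq {h : V → ℂ} (h1 : Integrable h) (h2 : MemLp h 2) :
    eLpNorm (𝓕 h) 2 volume = eLpNorm h 2 volume := by
  rw [← eLpNorm_congr_ae (fourier_toLp_ae_eq h1 h2), ← eLpNorm_congr_ae h2.coeFn_toLp,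
    ← Lp.enorm_def, ← Lp.enorm_def, ← ofReal_norm, ← ofReal_norm, Lp.norm_fourier_eq]

end Plancherel

/-! ### The unitary Fourier transform on the line with kernel `e^{2ixu}`. -/

theorem lintegral_enorm_sq_eq {α : Type*} [MeasurableSpace α] {μ : Measure α} (f : α → ℂ) :
    ∫⁻ a, ‖f a‖ₑ ^ 2 ∂μ = eLpNorm f 2 μ ^ 2 := by
  have h := eLpNorm_nnreal_pow_eq_lintegral (f := f) (μ := μ) (p := 2) (by norm_num)
  simpa using h.symm

/-- The unitary Fourier transform `h ↦ π^{-1/2} ∫ h(u) e^{2ixu} du`. -/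
noncomputable def waveFT (h : ℝ → ℂ) (x : ℝ) : ℂ :=
  ((√Real.pi)⁻¹ : ℝ) * ∫ u : ℝ, h u * Complex.exp (2 * Complex.I * x * u)

theorem waveFT_eq (h : ℝ → ℂ) (x : ℝ) :
    waveFT h x = ((√Real.pi)⁻¹ : ℝ) * FourierTransform.fourier h (x * -Real.pi⁻¹) := by
  rw [waveFT, Real.fourier_eq']
  congr 1
  refine integral_congr_ae (Eventually.of_forall fun u => ?_)
  simp only [smul_eq_mul, RCLike.inner_apply, conj_trivial]
  rw [mul_comm]
  congr 2
  push_cast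
  have : (Real.pi : ℂ) ≠ 0 := by exact_mod_cast Real.pi_ne_zero
  field_simp

theorem lintegral_comp_mul_right_real (f : ℝ → ENNReal) {a : ℝ} (ha : a ≠ 0) :
    ∫⁻ x, f (x * a) = ENNReal.ofReal |a⁻¹| * ∫⁻ x, f x := by
  have h := Real.map_volume_mul_right ha
  have e : MeasurableEmbedding fun x : ℝ => x * a :=
    (Homeomorph.mulRight₀ a ha).measurableEmbedding
  rw [← e.lintegral_map, h, lintegral_smul_measure, smul_eq_mul]

/-- The kernel `e^{2ixu}` is the standard one at frequency `-x/π`; the Jacobian `π` of this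
rescaling cancels the square of the prefactor `π^{-1/2}`. -/
theorem lintegral_waveFT {h : ℝ → ℂ} (h1 : Integrable h) (h2 : MemLp h 2) :
    ∫⁻ x, ‖waveFT h x‖ₑ ^ 2 = ∫⁻ u, ‖h u‖ₑ ^ 2 := by
  have hp := Real.pi_pos
  have e : ∀ x, ‖waveFT h x‖ₑ ^ 2 = ENNReal.ofReal Real.pi⁻¹ *
      ‖FourierTransform.fourier h (x * -Real.pi⁻¹)‖ₑ ^ 2 := by
    intro x
    rw [waveFT_eq, enorm_mul, mul_pow, ← ofReal_norm, Complex.norm_real,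
      Real.norm_of_nonneg (by positivity), ← ENNReal.ofReal_pow (by positivity), inv_pow,
      Real.sq_sqrt hp.le]
  simp_rw [e]
  rw [lintegral_const_mul' _ _ ENNReal.ofReal_ne_top,
    lintegral_comp_mul_right_real (fun x => ‖FourierTransform.fourier h x‖ₑ ^ 2)
      (by simp), ← mul_assoc, ← ENNReal.ofReal_mul (by positivity),
    lintegral_enorm_sq_eq, lintegral_enorm_sq_eq, eLpNorm_fourier_eq h1 h2]
  have : Real.pi⁻¹ * |(-Real.pi⁻¹)⁻¹| = 1 := by
    rw [inv_neg, inv_inv, abs_neg, abs_of_pos hp]; field_simp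
  rw [this]; simp

/-! ### The `Y`-representation of two-mode wavefunctions and its Plancherel theorem. -/

section

open FourierTransform

/-- The plane with its Euclidean inner product. -/
abbrev Plane : Type := WithLp 2 (ℝ × ℝ)

/-- The linear identification of the Euclidean plane with `ℝ × ℝ`. -/
noncomputable def planeEquiv : Plane ≃L[ℝ] ℝ × ℝ := WithLp.prodContinuousLinearEquiv 2 ℝ ℝ ℝ

theorem measurePreserving_planeEquiv : MeasurePreserving planeEquiv volume volume :=
  WithLp.volume_preserving_ofLp ℝ ℝ

theorem measurePreserving_planeEquiv_symm : MeasurePreserving planeEquiv.symm volume volume :=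
  WithLp.volume_preserving_toLp ℝ ℝ

/-- A Schwartz function on the Euclidean plane. -/
noncomputable def toPlane (Ψ : 𝓢(ℝ × ℝ, ℂ)) : 𝓢(Plane, ℂ) :=
  SchwartzMap.compCLMOfContinuousLinearEquiv ℂ planeEquiv Ψ

theorem toPlane_apply (Ψ : 𝓢(ℝ × ℝ, ℂ)) (w : Plane) : toPlane Ψ w = Ψ (planeEquiv w) := rfl

theorem yWave_eq_fourier (Ψ : 𝓢(ℝ × ℝ, ℂ)) (p : ℝ × ℝ) :
    yWave Ψ p = (Real.pi⁻¹ : ℝ) * 𝓕 (toPlane Ψ) (Real.pi⁻¹ • planeEquiv.symm p) := by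
  have hpi : (Real.pi : ℂ) ≠ 0 := by exact_mod_cast Real.pi_ne_zero
  have hs : ((√Real.pi : ℝ) : ℂ) ^ 2 = Real.pi := by
    exact_mod_cast Real.sq_sqrt Real.pi_pos.le
  have hs0 : ((√Real.pi : ℝ) : ℂ) ≠ 0 := by
    exact_mod_cast (Real.sqrt_pos.2 Real.pi_pos).ne'
  rw [SchwartzMap.fourier_coe, Real.fourier_eq', yWave,
    ← measurePreserving_planeEquiv.integral_comp
      planeEquiv.toHomeomorph.measurableEmbedding, ← integral_const_mul]
  refine integral_congr_ae (Eventually.of_forall fun w => ?_)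
  have hi : inner ℝ w (Real.pi⁻¹ • planeEquiv.symm p) =
      Real.pi⁻¹ * ((planeEquiv w).1 * p.1 + (planeEquiv w).2 * p.2) := by
    rw [inner_smul_right, WithLp.prod_inner_apply]
    simp only [RCLike.inner_apply, conj_trivial]
    simp [planeEquiv, mul_comm]
  simp only [hi, toPlane_apply, eigY, smul_eq_mul, map_mul, ← Complex.exp_conj,
    Complex.conj_ofReal, Complex.conj_I, map_ofNat]
  have e1 : ∀ a b c : ℂ, ((((√Real.pi)⁻¹ : ℝ) : ℂ) * a * ((((√Real.pi)⁻¹ : ℝ) : ℂ) * b)) * c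
      = ((Real.pi⁻¹ : ℝ) : ℂ) * (a * b * c) := by
    intro a b c
    push_cast
    rw [← hs]
    field_simp
  rw [e1, ← Complex.exp_add]
  congr 3
  push_cast
  field_simp
  ring

/-- The two-mode wavefunction in the `Y`-representation, as a Schwartz function. -/
noncomputable def yWaveS (Ψ : 𝓢(ℝ × ℝ, ℂ)) : 𝓢(ℝ × ℝ, ℂ) :=
  (Real.pi⁻¹ : ℂ) • SchwartzMap.compCLMOfContinuousLinearEquiv ℂ
    (planeEquiv.symm.trans (ContinuousLinearEquiv.smulLeft (Units.mk0 Real.pi⁻¹ (by simp))))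
    (𝓕 (toPlane Ψ))

theorem yWaveS_apply (Ψ : 𝓢(ℝ × ℝ, ℂ)) (p : ℝ × ℝ) : yWaveS Ψ p = yWave Ψ p := by
  rw [yWave_eq_fourier]
  simp [yWaveS]

theorem coe_yWaveS (Ψ : 𝓢(ℝ × ℝ, ℂ)) : ⇑(yWaveS Ψ) = yWave Ψ := funext (yWaveS_apply Ψ)

/-- Dilating the plane by `π` turns `yWave` into the standard Fourier transform. The Jacobian `π²`
meets the prefactor `1/π`, and the remaining `π` is attached to `κ` so that its dilate keeps the
`L²` norm. -/
theorem integral_yWave_mul (Ψ : 𝓢(ℝ × ℝ, ℂ)) (κ : ℝ × ℝ → ℂ) :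
    ∫ p, conj (yWave Ψ p) * κ p =
      ∫ w : Plane, conj (𝓕 (toPlane Ψ) w) * (Real.pi * κ (planeEquiv (Real.pi • w))) := by
  have hpi : (Real.pi : ℂ) ≠ 0 := by exact_mod_cast Real.pi_ne_zero
  rw [← measurePreserving_planeEquiv.integral_comp
      planeEquiv.toHomeomorph.measurableEmbedding]
  have h := Measure.integral_comp_smul (volume : Measure Plane)
    (fun w => conj (yWave Ψ (planeEquiv w)) * κ (planeEquiv w)) Real.pi
  have hd : Module.finrank ℝ Plane = 2 := by
    rw [planeEquiv.toLinearEquiv.finrank_eq]; simp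
  rw [hd, abs_of_pos (by have := Real.pi_pos; positivity)] at h
  have h' : ∫ w : Plane, conj (yWave Ψ (planeEquiv w)) * κ (planeEquiv w) =
      Real.pi ^ 2 * ∫ w : Plane, conj (yWave Ψ (planeEquiv (Real.pi • w))) *
        κ (planeEquiv (Real.pi • w)) := by
    rw [h, Complex.real_smul]; push_cast; field_simp
  rw [h', ← integral_const_mul]
  refine integral_congr_ae (Eventually.of_forall fun w => ?_)
  simp only [yWave_eq_fourier, ContinuousLinearEquiv.symm_apply_apply, smul_smul,
    inv_mul_cancel₀ Real.pi_ne_zero, one_smul, map_mul, Complex.conj_ofReal]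
  push_cast
  field_simp

/-- Square-integrable wavefunctions in the `Y`-representation define vectors. -/
theorem exists_vector_of_yWave {κ : ℝ × ℝ → ℂ} (hκ : MemLp κ 2 volume) :
    ∃ v : TwoMode, (∀ Ψ : 𝓢(ℝ × ℝ, ℂ), ⟪toTwoMode Ψ, v⟫_ℂ = ∫ p, conj (yWave Ψ p) * κ p) ∧
      ENNReal.ofReal (‖v‖ ^ 2) = ∫⁻ p, ‖κ p‖ₑ ^ 2 := by
  have hpi := Real.pi_pos
  set k : Plane → ℂ := fun w => Real.pi * κ (planeEquiv (Real.pi • w)) with hk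
  have hd : Module.finrank ℝ Plane = 2 := by
    rw [planeEquiv.toLinearEquiv.finrank_eq]; simp
  have hmap : Measure.map (fun w : Plane => Real.pi • w) volume =
      ENNReal.ofReal (Real.pi ^ 2)⁻¹ • (volume : Measure Plane) := by
    rw [Measure.map_addHaar_smul _ hpi.ne', hd, abs_of_pos (by positivity)]
  have hκ' : MemLp (fun w => κ (planeEquiv w)) 2 (volume : Measure Plane) :=
    hκ.comp_measurePreserving measurePreserving_planeEquiv
  have hκs : MemLp (fun w : Plane => κ (planeEquiv (Real.pi • w))) 2 volume := by
    have : MemLp (fun w => κ (planeEquiv w)) 2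
        (Measure.map (fun w : Plane => Real.pi • w) volume) := by
      rw [hmap]; exact hκ'.smul_measure ENNReal.ofReal_ne_top
    exact this.comp_of_map (by fun_prop)
  have hk2 : MemLp k 2 volume := hκs.const_mul _
  have hkn : ∫⁻ w, ‖k w‖ₑ ^ 2 = ∫⁻ p, ‖κ p‖ₑ ^ 2 := by
    simp_rw [hk, enorm_mul, mul_pow]
    rw [lintegral_const_mul' _ _ (by simp)]
    have e : MeasurableEmbedding fun w : Plane => Real.pi • w :=
      (Homeomorph.smulOfNeZero Real.pi hpi.ne').measurableEmbedding
    rw [← e.lintegral_map (fun w => ‖κ (planeEquiv w)‖ₑ ^ 2), hmap, lintegral_smul_measure,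
      smul_eq_mul, ← mul_assoc, ← ofReal_norm, Complex.norm_real, Real.norm_of_nonneg hpi.le,
      ← ENNReal.ofReal_pow hpi.le, ← ENNReal.ofReal_mul (by positivity),
      mul_inv_cancel₀ (by positivity), ENNReal.ofReal_one, one_mul,
      measurePreserving_planeEquiv.lintegral_comp_emb
        planeEquiv.toHomeomorph.measurableEmbedding (fun w => ‖κ w‖ₑ ^ 2)]
  -- The vector sought is the inverse Fourier transform of the dilated wavefunction, carried from
  -- the Euclidean plane to `ℝ × ℝ`.
  set u : Lp ℂ 2 (volume : Measure Plane) := 𝓕⁻ (hk2.toLp k) with hu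
  have hFu : 𝓕 u = hk2.toLp k := FourierTransform.fourier_fourierInv_eq _
  have hv := (Lp.memLp u).comp_measurePreserving measurePreserving_planeEquiv_symm
  refine ⟨hv.toLp _, fun Ψ => ?_, ?_⟩
  · have e1 : ⟪toTwoMode Ψ, hv.toLp _⟫_ℂ = ⟪(toPlane Ψ).toLp 2 volume, u⟫_ℂ := by
      rw [L2.inner_def, L2.inner_def]
      have a1 : ∫ q, ⟪(toTwoMode Ψ : ℝ × ℝ → ℂ) q, (hv.toLp _ : TwoMode) q⟫_ℂ =
          ∫ q, ⟪Ψ q, u (planeEquiv.symm q)⟫_ℂ := by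
        refine integral_congr_ae ?_
        filter_upwards [Ψ.coeFn_toLp 2 volume, hv.coeFn_toLp] with q h1 h2
        rw [h1, h2]; rfl
      have a2 : ∫ w, ⟪(toPlane Ψ).toLp 2 volume w, u w⟫_ℂ =
          ∫ w, ⟪Ψ (planeEquiv w), u (planeEquiv.symm (planeEquiv w))⟫_ℂ := by
        refine integral_congr_ae ?_
        filter_upwards [(toPlane Ψ).coeFn_toLp 2 volume] with q h1
        rw [h1, toPlane_apply, ContinuousLinearEquiv.symm_apply_apply]
      rw [a1, a2]
      exact (measurePreserving_planeEquiv.integral_comp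
        planeEquiv.toHomeomorph.measurableEmbedding
        (fun q => ⟪Ψ q, u (planeEquiv.symm q)⟫_ℂ)).symm
    rw [e1, ← Lp.inner_fourier_eq, hFu, SchwartzMap.toLp_fourier_eq, L2.inner_def,
      integral_yWave_mul]
    refine integral_congr_ae ?_
    filter_upwards [(𝓕 (toPlane Ψ)).coeFn_toLp 2 volume, hk2.coeFn_toLp] with w h1 h2
    rw [h1, h2, RCLike.inner_apply, mul_comm]
  · rw [Lp.norm_toLp, eLpNorm_comp_measurePreserving (Lp.memLp u).1
      measurePreserving_planeEquiv_symm, ← Lp.norm_def, ← Lp.norm_fourier_eq u, hFu, ← hkn,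
      lintegral_enorm_sq_eq, ENNReal.ofReal_pow (norm_nonneg _), ofReal_norm, Lp.enorm_toLp]

theorem inner_toLp_eq {V : Type*} [NormedAddCommGroup V] [NormedSpace ℝ V] [MeasurableSpace V]
    [BorelSpace V] [SecondCountableTopology V] {μ : Measure V} [μ.HasTemperateGrowth]
    (f g : 𝓢(V, ℂ)) : ⟪f.toLp 2 μ, g.toLp 2 μ⟫_ℂ = ∫ x, conj (f x) * g x ∂μ := by
  rw [L2.inner_def]
  refine integral_congr_ae ?_
  filter_upwards [f.coeFn_toLp 2 μ, g.coeFn_toLp 2 μ] with x h1 h2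
  rw [h1, h2, RCLike.inner_apply, mul_comm]

theorem norm_toLp_yWaveS (Ψ : 𝓢(ℝ × ℝ, ℂ)) : ‖toTwoMode (yWaveS Ψ)‖ = ‖toTwoMode Ψ‖ := by
  have e : ⟪toTwoMode (yWaveS Ψ), toTwoMode (yWaveS Ψ)⟫_ℂ = ⟪toTwoMode Ψ, toTwoMode Ψ⟫_ℂ := by
    have hpi : (Real.pi : ℂ) ≠ 0 := by exact_mod_cast Real.pi_ne_zero
    rw [inner_toLp_eq, inner_toLp_eq]
    simp_rw [yWaveS_apply]
    rw [integral_yWave_mul, ← measurePreserving_planeEquiv.integral_comp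
      planeEquiv.toHomeomorph.measurableEmbedding]
    simp_rw [← toPlane_apply]
    rw [← inner_toLp_eq, ← SchwartzMap.inner_fourier_toL2_eq, inner_toLp_eq]
    refine integral_congr_ae (Eventually.of_forall fun w => ?_)
    simp only [yWave_eq_fourier, ContinuousLinearEquiv.symm_apply_apply, map_smul, smul_smul,
      inv_mul_cancel₀ Real.pi_ne_zero, one_smul]
    push_cast
    field_simp
  rw [inner_self_eq_norm_sq_to_K, inner_self_eq_norm_sq_to_K] at e
  have e' : ‖toTwoMode (yWaveS Ψ)‖ ^ 2 = ‖toTwoMode Ψ‖ ^ 2 := by exact_mod_cast e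
  exact (sq_eq_sq₀ (norm_nonneg _) (norm_nonneg _)).1 e'

theorem lintegral_yWave (Ψ : 𝓢(ℝ × ℝ, ℂ)) :
    ∫⁻ p, ‖yWave Ψ p‖ₑ ^ 2 = ENNReal.ofReal (‖toTwoMode Ψ‖ ^ 2) := by
  rw [lintegral_enorm_sq_eq, ← norm_toLp_yWaveS, ← coe_yWaveS,
    ENNReal.ofReal_pow (norm_nonneg _), ofReal_norm, Lp.enorm_def,
    eLpNorm_congr_ae ((yWaveS Ψ).coeFn_toLp 2 volume)]

end

/-! ### Coordinates `(u, r) ↦ (u, ± e ^ r u)` -/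

theorem sign_mul_self (s : ℤˣ) : ((s : ℤ) : ℝ) * ((s : ℤ) : ℝ) = 1 := by
  rcases Int.units_eq_one_or s with rfl | rfl <;> norm_num

theorem abs_sign (s : ℤˣ) : |((s : ℤ) : ℝ)| = 1 := by
  rcases Int.units_eq_one_or s with rfl | rfl <;> norm_num

/-- The points of the Fourier plane which the affine group moves along the line `y' = s y`. -/
noncomputable def orbitMap (s : ℤˣ) (p : ℝ × ℝ) : ℝ × ℝ :=
  (p.1, ((s : ℤ) : ℝ) * (Real.exp p.2 * p.1))

/-- The union of the two open quadrants in which `s y y' > 0`. -/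
def quadrants (s : ℤˣ) : Set (ℝ × ℝ) := {p | 0 < ((s : ℤ) : ℝ) * (p.1 * p.2)}

/-- The measure on the `(u, r)` plane which corresponds to Lebesgue measure. -/
noncomputable def orbitMeasure : Measure (ℝ × ℝ) :=
  volume.withDensity fun p => ENNReal.ofReal (Real.exp p.2 * |p.1|)

theorem continuous_orbitMap (s : ℤˣ) : Continuous (orbitMap s) := by
  unfold orbitMap; fun_prop

theorem measurableSet_quadrants (s : ℤˣ) : MeasurableSet (quadrants s) :=
  measurableSet_lt measurable_const (by fun_prop)

/-- For fixed `u ≠ 0` the map `r ↦ s e^r u` is a bijection onto an open half-line and is its own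
derivative, whence the weight `e^r |u|`. -/
theorem lintegral_exp_mul_comp (s : ℤˣ) {u : ℝ} (hu : u ≠ 0) (F : ℝ → ENNReal) :
    ∫⁻ r, ENNReal.ofReal (Real.exp r * |u|) * F (((s : ℤ) : ℝ) * (Real.exp r * u)) =
      ∫⁻ u' in {u' | 0 < ((s : ℤ) : ℝ) * (u * u')}, F u' := by
  have hs := sign_mul_self s
  have hs0 : ((s : ℤ) : ℝ) ≠ 0 := fun h => by simp [h] at hs
  have himg : (fun r => ((s : ℤ) : ℝ) * (Real.exp r * u)) '' univ =
      {u' | 0 < ((s : ℤ) : ℝ) * (u * u')} := by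
    ext t
    simp only [image_univ, mem_range, mem_ofPred_eq]
    constructor
    · rintro ⟨r, rfl⟩
      have : ((s : ℤ) : ℝ) * (u * (((s : ℤ) : ℝ) * (Real.exp r * u))) = Real.exp r * u ^ 2 := by
        linear_combination (Real.exp r * u ^ 2) * hs
      rw [this]; positivity
    · intro h
      have h' : 0 < ((s : ℤ) : ℝ) * t / u := by
        have : ((s : ℤ) : ℝ) * t / u = ((s : ℤ) : ℝ) * (u * t) / u ^ 2 := by field_simp
        rw [this]; positivity
      refine ⟨Real.log (((s : ℤ) : ℝ) * t / u), ?_⟩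
      rw [Real.exp_log h', div_mul_cancel₀ _ hu, ← mul_assoc, hs, one_mul]
  have h := lintegral_image_eq_lintegral_abs_deriv_mul (s := univ)
    (f := fun r => ((s : ℤ) : ℝ) * (Real.exp r * u)) (f' := fun r => ((s : ℤ) : ℝ) * (Real.exp r * u))
    MeasurableSet.univ
    (fun r _ => (((Real.hasDerivAt_exp r).mul_const u).const_mul _).hasDerivWithinAt)
    (fun a _ b _ hab => by
      simpa [hs0, hu] using hab) F
  rw [himg] at h
  rw [h, Measure.restrict_univ]
  refine lintegral_congr fun r => ?_
  rw [abs_mul, abs_sign, one_mul, abs_mul, abs_of_pos (Real.exp_pos r)]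

/-- Tonelli reduces this to the change of variables on each vertical line; the line `u = 0`, where
the coordinates degenerate, is null. -/
theorem map_orbitMap (s : ℤˣ) :
    Measure.map (orbitMap s) orbitMeasure = volume.restrict (quadrants s) := by
  ext S hS
  rw [Measure.map_apply (continuous_orbitMap s).measurable hS,
    Measure.restrict_apply hS, orbitMeasure,
    withDensity_apply _ ((continuous_orbitMap s).measurable hS),
    ← lintegral_indicator ((continuous_orbitMap s).measurable hS), Measure.volume_eq_prod,
    lintegral_prod _ (by
      refine (Measurable.indicator ?_ ((continuous_orbitMap s).measurable hS)).aemeasurable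
      fun_prop),
    Measure.prod_apply (hS.inter (measurableSet_quadrants s))]
  refine lintegral_congr_ae ?_
  filter_upwards [Measure.ae_ne volume (0 : ℝ)] with u hu
  have h := lintegral_exp_mul_comp s hu (indicator {u' | (u, u') ∈ S} 1)
  have hm : MeasurableSet {u' | (u, u') ∈ S} := measurable_prodMk_left hS
  rw [lintegral_indicator_one hm, Measure.restrict_apply hm] at h
  refine Eq.trans (lintegral_congr fun r => ?_) h
  simp only [indicator, orbitMap, mem_preimage, mem_ofPred_eq, Pi.one_apply, mul_ite, mul_one,
    mul_zero]
  rfl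

/-! ### Transformation of the `Y`-representation -/

/-- The affine map of the first variable as a measurable equivalence. -/
noncomputable def affShiftEquiv (g : ℝ × ℝ) : ℝ × ℝ ≃ᵐ ℝ × ℝ where
  toFun := affShift g
  invFun := affShift (affInv g)
  left_inv := affShift_affInv g
  right_inv q := by
    have h := affShift_affInv (affInv g) q
    rwa [affInv_affInv] at h
  measurable_toFun := measurable_affShift g
  measurable_invFun := measurable_affShift _

theorem integral_comp_affShift (g : ℝ × ℝ) (F : ℝ × ℝ → ℂ) :
    ∫ q, F (affShift g q) = (Real.exp g.2 : ℂ) * ∫ q, F q := by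
  have h := (affShiftEquiv g).measurableEmbedding.integral_map (μ := volume) F
  have e : (affShiftEquiv g : ℝ × ℝ → ℝ × ℝ) = affShift g := rfl
  rw [e, map_affShift, integral_smul_measure, ENNReal.toReal_ofReal (Real.exp_pos _).le,
    Complex.real_smul] at h
  exact h.symm

theorem yWave_affAct₂ (h : ℝ × ℝ) (Ψ : ℝ × ℝ → ℂ) (p : ℝ × ℝ) :
    yWave (affAct₂ h Ψ) p = (Real.exp (h.2 / 2) : ℂ) *
      Complex.exp (-(2 * Complex.I * h.1 * p.1)) * yWave Ψ (Real.exp h.2 * p.1, p.2) := by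
  have hE : Real.exp h.2 * Real.exp (-h.2) = 1 := by rw [← Real.exp_add]; simp
  have e := integral_comp_affShift h fun q => conj (eigY p.1 (Real.exp h.2 * q.1 + h.1) *
    eigY p.2 q.2) * ((Real.exp (-h.2 / 2) : ℂ) * Ψ q)
  have e0 : yWave (affAct₂ h Ψ) p = ∫ q, (fun q : ℝ × ℝ => conj (eigY p.1 (Real.exp h.2 * q.1 + h.1) *
      eigY p.2 q.2) * ((Real.exp (-h.2 / 2) : ℂ) * Ψ q)) (affShift h q) := by
    refine integral_congr_ae (Eventually.of_forall fun q => ?_)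
    simp only [affAct₂_apply]
    have : Real.exp h.2 * (affShift h q).1 + h.1 = q.1 := by
      simp only [affShift]; linear_combination (q.1 - h.1) * hE
    rw [this]; rfl
  rw [e0, e, yWave, ← integral_const_mul, ← integral_const_mul]
  refine integral_congr_ae (Eventually.of_forall fun q => ?_)
  simp only [eigY, map_mul, ← Complex.exp_conj, Complex.conj_ofReal, Complex.conj_I, map_ofNat]
  have e1 : (Real.exp h.2 : ℂ) * (Real.exp (-h.2 / 2) : ℂ) = (Real.exp (h.2 / 2) : ℂ) := by
    rw [← Complex.ofReal_mul, ← Real.exp_add]; congr 2; ring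
  have e2 : Complex.exp (2 * -Complex.I * ((Real.exp h.2 * q.1 + h.1 : ℝ) : ℂ) * p.1) =
      Complex.exp (-(2 * Complex.I * h.1 * p.1)) *
        Complex.exp (2 * -Complex.I * q.1 * ((Real.exp h.2 * p.1 : ℝ) : ℂ)) := by
    rw [← Complex.exp_add]; congr 1; push_cast; ring
  rw [e2, ← e1]
  ring

/-- The restriction of a `Y`-wavefunction to a line `y' = ± e ^ r y`, with its weight. -/
noncomputable def orbitSlice (s : ℤˣ) (Ψ : 𝓢(ℝ × ℝ, ℂ)) (r u : ℝ) : ℂ :=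
  (√|u| : ℂ) * yWave Ψ (orbitMap s (u, r))

/-- Substituting `y = e^r u` gives `e^r` from `dy` and `e^{r/2}` from `√|y|`; the latter cancels the
`e^{-r/2}` of `U_g†`. The phase of the inverse displacement becomes the Fourier kernel. -/
theorem amp_eq (s : ℤˣ) (g : ℝ × ℝ) (Ψ : 𝓢(ℝ × ℝ, ℂ)) :
    amp s g Ψ = (Real.exp g.2 : ℂ) * waveFT (orbitSlice s Ψ g.2) g.1 := by
  have hE : Real.exp (-g.2) * Real.exp g.2 = 1 := by rw [← Real.exp_add]; simp
  have h := Measure.integral_comp_mul_left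
    (fun y : ℝ => (√|y| : ℂ) * yWave (affAct₂ (affInv g) Ψ) (y, ((s : ℤ) : ℝ) * y)) (Real.exp g.2)
  rw [abs_of_pos (inv_pos.2 (Real.exp_pos _)), ← Real.exp_neg, Complex.real_smul] at h
  have h' : ∫ y : ℝ, (√|y| : ℂ) * yWave (affAct₂ (affInv g) Ψ) (y, ((s : ℤ) : ℝ) * y) =
      (Real.exp g.2 : ℂ) * ∫ x : ℝ, (√|Real.exp g.2 * x| : ℂ) * yWave (affAct₂ (affInv g) Ψ)
        (Real.exp g.2 * x, ((s : ℤ) : ℝ) * (Real.exp g.2 * x)) := by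
    rw [h, ← mul_assoc, ← Complex.ofReal_mul, mul_comm (Real.exp g.2), hE]; simp
  rw [amp, pointerY, h', waveFT, mul_left_comm]
  congr 2
  refine integral_congr_ae (Eventually.of_forall fun u => ?_)
  simp only [yWave_affAct₂, affInv, orbitSlice, orbitMap]
  have e1 : Real.exp (-g.2) * (Real.exp g.2 * u) = u := by rw [← mul_assoc, hE, one_mul]
  have e2 : (√|Real.exp g.2 * u| : ℂ) * (Real.exp (-g.2 / 2) : ℂ) = (√|u| : ℂ) := by
    rw [abs_mul, abs_of_pos (Real.exp_pos _), Real.sqrt_mul (Real.exp_pos _).le,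
      ← Real.exp_half, mul_comm (Real.exp _), ← Complex.ofReal_mul, mul_assoc, ← Real.exp_add]
    simp [neg_div]
  have e3 : -(2 * Complex.I * ((-(Real.exp (-g.2) * g.1) : ℝ) : ℂ) * ((Real.exp g.2 * u : ℝ) : ℂ)) =
      2 * Complex.I * g.1 * u := by
    have hE' : ((Real.exp (-g.2) : ℝ) : ℂ) * ((Real.exp g.2 : ℝ) : ℂ) = 1 := by
      exact_mod_cast hE
    rw [Complex.ofReal_neg, Complex.ofReal_mul, Complex.ofReal_mul]
    linear_combination (2 * Complex.I * g.1 * u) * hE'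
  rw [e1, e3, ← e2]
  ring

/-! ### Decay, integrability and measurability of slices and amplitudes. -/

/-- The bound involves only the first coordinate, so it is uniform over the lines `y' = s e^r y`. Of
the two decaying factors one absorbs `√|u|` and the other is integrable. -/
theorem yWave_decay (Ψ : 𝓢(ℝ × ℝ, ℂ)) :
    ∃ C : ℝ, 0 ≤ C ∧ ∀ p : ℝ × ℝ, ‖yWave Ψ p‖ ≤ C * ((1 + p.1 ^ 2)⁻¹) ^ 2 := by
  obtain ⟨C0, h0⟩ := (yWaveS Ψ).decay 0 0
  obtain ⟨C4, h4⟩ := (yWaveS Ψ).decay 4 0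
  have hC : 0 ≤ 2 * (C0 + C4) := by linarith [h0.1, h4.1]
  refine ⟨2 * (C0 + C4), hC, fun p => ?_⟩
  have a0 := h0.2 p
  have a4 := h4.2 p
  rw [norm_iteratedFDeriv_zero, yWaveS_apply] at a0 a4
  have hp : p.1 ^ 2 ≤ ‖p‖ ^ 2 := by
    rw [← sq_abs]; exact pow_le_pow_left₀ (abs_nonneg _) (norm_fst_le p) 2
  have hb : (1 + p.1 ^ 2) ^ 2 ≤ 2 * (1 + ‖p‖ ^ 4) := by
    nlinarith [sq_nonneg (p.1 ^ 2 - 1), sq_nonneg p.1, sq_nonneg ‖p‖]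
  have : (1 + p.1 ^ 2) ^ 2 * ‖yWave Ψ p‖ ≤ 2 * (C0 + C4) := by
    calc _ ≤ 2 * (1 + ‖p‖ ^ 4) * ‖yWave Ψ p‖ := by gcongr
      _ = 2 * (‖p‖ ^ 0 * ‖yWave Ψ p‖ + ‖p‖ ^ 4 * ‖yWave Ψ p‖) := by ring
      _ ≤ _ := by gcongr
  rw [inv_pow, ← div_eq_mul_inv, le_div_iff₀ (by positivity)]
  linarith

theorem sqrt_abs_le_one_add_sq (u : ℝ) : √|u| ≤ 1 + u ^ 2 := by
  rw [Real.sqrt_le_left (by positivity), ← sq_abs u]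
  nlinarith [sq_nonneg (|u| - 1), abs_nonneg u, sq_nonneg |u|, sq_nonneg (|u| ^ 2)]

theorem orbitSlice_decay (s : ℤˣ) (Ψ : 𝓢(ℝ × ℝ, ℂ)) :
    ∃ C : ℝ, 0 ≤ C ∧ ∀ r u, ‖orbitSlice s Ψ r u‖ ≤ C * (1 + u ^ 2)⁻¹ := by
  obtain ⟨C, hC, h⟩ := yWave_decay Ψ
  refine ⟨C, hC, fun r u => ?_⟩
  have h1 := h (orbitMap s (u, r))
  have h2 := sqrt_abs_le_one_add_sq u
  rw [orbitSlice, norm_mul, Complex.norm_real, Real.norm_of_nonneg (Real.sqrt_nonneg _)]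
  have h3 : (0 : ℝ) < 1 + u ^ 2 := by positivity
  calc _ ≤ (1 + u ^ 2) * (C * ((1 + u ^ 2)⁻¹) ^ 2) :=
        mul_le_mul h2 h1 (norm_nonneg _) h3.le
    _ = _ := by field_simp

theorem continuous_yWave (Ψ : 𝓢(ℝ × ℝ, ℂ)) : Continuous (yWave Ψ) := by
  rw [← coe_yWaveS]; exact (yWaveS Ψ).continuous

theorem continuous_orbitSlice (s : ℤˣ) (Ψ : 𝓢(ℝ × ℝ, ℂ)) :
    Continuous fun p : ℝ × ℝ => orbitSlice s Ψ p.1 p.2 := by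
  have h1 := continuous_yWave Ψ
  have h2 := continuous_orbitMap s
  unfold orbitSlice
  fun_prop

theorem continuous_orbitSlice_right (s : ℤˣ) (Ψ : 𝓢(ℝ × ℝ, ℂ)) (r : ℝ) :
    Continuous (orbitSlice s Ψ r) :=
  (continuous_orbitSlice s Ψ).comp (by fun_prop : Continuous fun u : ℝ => (r, u))

theorem integrable_orbitSlice (s : ℤˣ) (Ψ : 𝓢(ℝ × ℝ, ℂ)) (r : ℝ) :
    Integrable (orbitSlice s Ψ r) := by
  obtain ⟨C, hC, h⟩ := orbitSlice_decay s Ψ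
  exact (integrable_inv_one_add_sq.const_mul C).mono'
    (continuous_orbitSlice_right s Ψ r).aestronglyMeasurable (Eventually.of_forall (h r))

theorem memLp_orbitSlice (s : ℤˣ) (Ψ : 𝓢(ℝ × ℝ, ℂ)) (r : ℝ) :
    MemLp (orbitSlice s Ψ r) 2 := by
  obtain ⟨C, hC, h⟩ := orbitSlice_decay s Ψ
  rw [memLp_two_iff_integrable_sq_norm (continuous_orbitSlice_right s Ψ r).aestronglyMeasurable]
  refine (integrable_inv_one_add_sq.const_mul (C ^ 2)).mono'
    ((continuous_orbitSlice_right s Ψ r).norm.pow 2).aestronglyMeasurable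
    (Eventually.of_forall fun u => ?_)
  have h3 : (0 : ℝ) < (1 + u ^ 2)⁻¹ := by positivity
  have h4 : (1 + u ^ 2)⁻¹ ≤ 1 := inv_le_one_of_one_le₀ (by nlinarith [sq_nonneg u])
  rw [Real.norm_of_nonneg (by positivity)]
  calc _ ≤ (C * (1 + u ^ 2)⁻¹) ^ 2 := by gcongr; exact h r u
    _ = C ^ 2 * ((1 + u ^ 2)⁻¹ * (1 + u ^ 2)⁻¹) := by ring
    _ ≤ C ^ 2 * ((1 + u ^ 2)⁻¹ * 1) := by gcongr
    _ = _ := by ring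

theorem stronglyMeasurable_amp (s : ℤˣ) (Ψ : 𝓢(ℝ × ℝ, ℂ)) :
    StronglyMeasurable fun g => amp s g Ψ := by
  have h1 := continuous_yWave Ψ
  have h2 := continuous_orbitMap s
  have hc : Continuous fun z : (ℝ × ℝ) × ℝ =>
      orbitSlice s Ψ z.1.2 z.2 * Complex.exp (2 * Complex.I * z.1.1 * z.2) := by
    unfold orbitSlice; fun_prop
  have h := hc.stronglyMeasurable.integral_prod_right' (ν := volume)
  simp_rw [amp_eq, waveFT]
  exact (by fun_prop : Continuous fun g : ℝ × ℝ => (Real.exp g.2 : ℂ)).stronglyMeasurable.mul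
    (h.const_mul _)

/-! ### The amplitudes preserve the norm. -/

theorem lintegral_haarL (F : ℝ × ℝ → ENNReal) :
    ∫⁻ g, F g ∂haarL = ∫⁻ g : ℝ × ℝ, ENNReal.ofReal (Real.exp (-g.2)) * F g := by
  rw [haarL, lintegral_withDensity_eq_lintegral_mul_non_measurable _ (by fun_prop)
    (Eventually.of_forall fun _ => ENNReal.ofReal_lt_top)]
  rfl

/-- For fixed `r`, Plancherel in `x` replaces the amplitude by the slice. The powers `e^{-r}` (Haar
measure), `e^{2r}` (squared prefactor) and `|u|` (squared weight) multiply to the Jacobian `e^r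
|u|`. -/
theorem lintegral_amp (s : ℤˣ) (Ψ : 𝓢(ℝ × ℝ, ℂ)) :
    ∫⁻ g, ‖amp s g Ψ‖ₑ ^ 2 ∂haarL = ∫⁻ p in quadrants s, ‖yWave Ψ p‖ₑ ^ 2 := by
  have hm : Measurable fun p => ‖yWave Ψ p‖ₑ ^ 2 :=
    (continuous_yWave Ψ).measurable.enorm.pow_const 2
  rw [← map_orbitMap, lintegral_map hm (continuous_orbitMap s).measurable, orbitMeasure,
    lintegral_withDensity_eq_lintegral_mul_non_measurable _ (by fun_prop)
    (Eventually.of_forall fun _ => ENNReal.ofReal_lt_top), lintegral_haarL,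
    Measure.volume_eq_prod, lintegral_prod_symm _ (by
      have := (stronglyMeasurable_amp s Ψ).measurable
      fun_prop), lintegral_prod_symm _ (by
      have := hm.comp (continuous_orbitMap s).measurable
      refine Measurable.aemeasurable (Measurable.mul ?_ this)
      fun_prop)]
  refine lintegral_congr fun r => ?_
  have e : ∀ x, ENNReal.ofReal (Real.exp (-r)) * ‖amp s (x, r) Ψ‖ₑ ^ 2 =
      ENNReal.ofReal (Real.exp r) * ‖waveFT (orbitSlice s Ψ r) x‖ₑ ^ 2 := by
    intro x
    rw [amp_eq, enorm_mul, mul_pow, ← ofReal_norm, Complex.norm_real,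
      Real.norm_of_nonneg (Real.exp_pos _).le, ← ENNReal.ofReal_pow (Real.exp_pos _).le,
      ← mul_assoc, ← ENNReal.ofReal_mul (Real.exp_pos _).le, sq, ← Real.exp_add,
      ← Real.exp_add]
    congr 3
    ring
  simp_rw [e]
  rw [lintegral_const_mul' _ _ ENNReal.ofReal_ne_top,
    lintegral_waveFT (integrable_orbitSlice s Ψ r) (memLp_orbitSlice s Ψ r),
    ← lintegral_const_mul' _ _ ENNReal.ofReal_ne_top]
  refine lintegral_congr fun u => ?_
  rw [Pi.mul_apply, orbitSlice, enorm_mul, mul_pow, ← ofReal_norm, Complex.norm_real,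
    Real.norm_of_nonneg (Real.sqrt_nonneg _), ← ENNReal.ofReal_pow (Real.sqrt_nonneg _),
    Real.sq_sqrt (abs_nonneg _), ← mul_assoc, ← ENNReal.ofReal_mul (Real.exp_pos _).le]

theorem sum_restrict_quadrants :
    ∑ s : ℤˣ, (volume : Measure (ℝ × ℝ)).restrict (quadrants s) = volume := by
  have hd : Disjoint (quadrants 1) (quadrants (-1)) := by
    rw [Set.disjoint_left]
    intro p h1 h2
    simp only [quadrants, mem_ofPred_eq] at h1 h2
    push_cast at h1 h2
    linarith
  rw [show (Finset.univ : Finset ℤˣ) = {1, -1} from rfl, Finset.sum_pair (by decide),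
    ← Measure.restrict_union hd (measurableSet_quadrants _)]
  refine Measure.restrict_eq_self_of_ae_mem ?_
  have h1 : ∀ᵐ p : ℝ × ℝ, p.1 ≠ 0 :=
    Measure.quasiMeasurePreserving_fst.ae (Measure.ae_ne volume (0 : ℝ))
  have h2 : ∀ᵐ p : ℝ × ℝ, p.2 ≠ 0 :=
    Measure.quasiMeasurePreserving_snd.ae (Measure.ae_ne volume (0 : ℝ))
  filter_upwards [h1, h2] with p h1 h2
  rcases lt_or_gt_of_ne (mul_ne_zero h1 h2) with h | h
  · right
    simp only [quadrants, mem_ofPred_eq]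
    push_cast
    linarith
  · left
    simp only [quadrants, mem_ofPred_eq]
    push_cast
    linarith

theorem sum_lintegral_amp (Ψ : 𝓢(ℝ × ℝ, ℂ)) :
    ∑ s : ℤˣ, ∫⁻ g, ‖amp s g Ψ‖ₑ ^ 2 ∂haarL = ENNReal.ofReal (‖toTwoMode Ψ‖ ^ 2) := by
  rw [← lintegral_yWave]
  simp_rw [lintegral_amp]
  conv_rhs => rw [← sum_restrict_quadrants]
  rw [lintegral_finsetSum_measure]

/-! ### Wave packets -/

instance isLocallyFiniteMeasure_haarL : IsLocallyFiniteMeasure haarL :=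
  IsLocallyFiniteMeasure.withDensity_ofReal (by fun_prop)

theorem memLp_two_of_lintegral_ne_top {α : Type*} [MeasurableSpace α] {μ : Measure α}
    {f : α → ℂ} (hf : AEStronglyMeasurable f μ) (h : ∫⁻ a, ‖f a‖ₑ ^ 2 ∂μ ≠ ⊤) :
    MemLp f 2 μ := by
  refine ⟨hf, ?_⟩
  rw [lintegral_enorm_sq_eq] at h
  exact lt_top_iff_ne_top.2 fun h' => h (by simp [h'])

theorem memLp_yWave (Ψ : 𝓢(ℝ × ℝ, ℂ)) : MemLp (yWave Ψ) 2 volume := by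
  rw [← coe_yWaveS]; exact (yWaveS Ψ).memLp 2 volume

theorem memLp_amp (s : ℤˣ) (Ψ : 𝓢(ℝ × ℝ, ℂ)) : MemLp (fun g => amp s g Ψ) 2 haarL := by
  refine memLp_two_of_lintegral_ne_top (stronglyMeasurable_amp s Ψ).aestronglyMeasurable ?_
  rw [lintegral_amp]
  refine ne_top_of_le_ne_top ?_ (setLIntegral_le_lintegral _ _)
  rw [lintegral_yWave]
  exact ENNReal.ofReal_ne_top

theorem integrable_mul_of_memLp_two {α : Type*} [MeasurableSpace α] {μ : Measure α}
    {f g : α → ℂ} (hf : MemLp f 2 μ) (hg : MemLp g 2 μ) :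
    Integrable (fun a => f a * conj (g a)) μ := by
  have : MemLp (fun a => conj (g a)) 2 μ := hg.star
  exact hf.integrable_mul this

/-- The partial Fourier transform in the displacement parameter. -/
noncomputable def paramFT (f : ℝ × ℝ → ℂ) (p : ℝ × ℝ) : ℂ := waveFT (fun x => f (x, p.2)) (-p.1)

/-- The wavefunction of `∫ d_L g f(g) U_g ⊗ 1 |Φ_s⟩⟩` in the `Y`-representation. -/
noncomputable def packetWave (f : ℝ × ℝ → ℂ) (s : ℤˣ) : ℝ × ℝ → ℂ :=
  indicator (quadrants s) fun p =>
    ((√|p.1| / |p.2| : ℝ) : ℂ) * paramFT f (p.1, Real.log |p.2 / p.1|)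

section

variable {f : ℝ × ℝ → ℂ}

theorem continuous_paramFT (hf : Continuous f) (hs : HasCompactSupport f) :
    Continuous (paramFT f) := by
  unfold paramFT waveFT
  refine continuous_const.mul ?_
  rw [← continuousOn_univ]
  refine continuousOn_integral_of_compact_support (hs.isCompact.image continuous_fst) ?_ ?_
  · apply Continuous.continuousOn
    simp only [Function.uncurry_def]
    fun_prop
  · intro p x _ hx
    have : (x, p.2) ∉ tsupport f := fun h => hx ⟨_, h, rfl⟩
    simp only [image_eq_zero_of_notMem_tsupport this, zero_mul]

theorem measurable_packetWave (hf : Continuous f) (hs : HasCompactSupport f) (s : ℤˣ) :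
    Measurable (packetWave f s) := by
  refine Measurable.indicator ?_ (measurableSet_quadrants s)
  have := (continuous_paramFT hf hs).measurable
  fun_prop

/-- On the orbit through `(u, s e^r u)` the logarithm in `packetWave` recovers `r`, and its
denominator cancels the Jacobian up to `√|u|`. -/
theorem packetWave_orbitMap (f : ℝ × ℝ → ℂ) (s : ℤˣ) {u : ℝ} (hu : u ≠ 0) (r : ℝ) :
    ((Real.exp r * |u| : ℝ) : ℂ) * packetWave f s (orbitMap s (u, r)) =
      (√|u| : ℂ) * paramFT f (u, r) := by
  have hs := sign_mul_self s
  have hmem : orbitMap s (u, r) ∈ quadrants s := by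
    have : ((s : ℤ) : ℝ) * (u * (((s : ℤ) : ℝ) * (Real.exp r * u))) = Real.exp r * u ^ 2 := by
      linear_combination (Real.exp r * u ^ 2) * hs
    simp only [quadrants, orbitMap, mem_ofPred_eq, this]
    positivity
  rw [packetWave, indicator_of_mem hmem]
  have e1 : |((s : ℤ) : ℝ) * (Real.exp r * u)| = Real.exp r * |u| := by
    rw [abs_mul, abs_sign, one_mul, abs_mul, abs_of_pos (Real.exp_pos r)]
  have hu' : |u| ≠ 0 := abs_ne_zero.2 hu
  have he := Real.exp_pos r
  simp only [orbitMap, abs_div, e1]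
  rw [mul_div_cancel_right₀ _ hu', Real.log_exp, ← mul_assoc, ← Complex.ofReal_mul]
  congr 2
  field_simp

/-- This isometry in the reverse direction is what later makes the amplitude operators surjective.
In orbit coordinates the squared modulus becomes `e^{-r} |paramFT f|²`, and Plancherel in `x` for
each `r` leaves the Haar norm of `f`. -/
theorem lintegral_packetWave (hf : Continuous f) (hs : HasCompactSupport f) (s : ℤˣ) :
    ∫⁻ p, ‖packetWave f s p‖ₑ ^ 2 = ∫⁻ g, ‖f g‖ₑ ^ 2 ∂haarL := by
  have hm := measurable_packetWave hf hs s
  have hF := (continuous_paramFT hf hs).measurable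
  have e0 : ∫⁻ p, ‖packetWave f s p‖ₑ ^ 2 = ∫⁻ p in quadrants s, ‖packetWave f s p‖ₑ ^ 2 := by
    rw [← lintegral_indicator (measurableSet_quadrants s)]
    refine lintegral_congr fun p => ?_
    by_cases h : p ∈ quadrants s
    · rw [indicator_of_mem h]
    · rw [indicator_of_notMem h, packetWave, indicator_of_notMem h]; simp
  have hne : ∀ᵐ p : ℝ × ℝ, p.1 ≠ 0 :=
    Measure.quasiMeasurePreserving_fst.ae (Measure.ae_ne volume (0 : ℝ))
  have e1 : ∫⁻ p in quadrants s, ‖packetWave f s p‖ₑ ^ 2 =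
      ∫⁻ p : ℝ × ℝ, ENNReal.ofReal (Real.exp (-p.2)) * ‖paramFT f p‖ₑ ^ 2 := by
    rw [← map_orbitMap, lintegral_map (hm.enorm.pow_const 2) (continuous_orbitMap s).measurable,
      orbitMeasure, lintegral_withDensity_eq_lintegral_mul_non_measurable _ (by fun_prop)
      (Eventually.of_forall fun _ => ENNReal.ofReal_lt_top)]
    refine lintegral_congr_ae ?_
    filter_upwards [hne] with p hp
    have h := congrArg (fun z : ℂ => ‖z‖ₑ ^ 2) (packetWave_orbitMap f s hp p.2)
    have hp' : 0 < |p.1| := abs_pos.2 hp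
    simp only [enorm_mul, mul_pow, ← ofReal_norm (Complex.ofReal _), Complex.norm_real] at h
    rw [Real.norm_of_nonneg (by positivity), Real.norm_of_nonneg (by positivity),
      ← ENNReal.ofReal_pow (by positivity), ← ENNReal.ofReal_pow (by positivity),
      Real.sq_sqrt (abs_nonneg _)] at h
    -- The squared identity `h` carries the Jacobian twice; multiplying by `e^{-r} / |u|` leaves it
    -- once on the left and `e^{-r}` on the right.
    have h2 : ENNReal.ofReal (Real.exp (-p.2) * |p.1|⁻¹) * ENNReal.ofReal ((Real.exp p.2 * |p.1|) ^ 2)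
        = ENNReal.ofReal (Real.exp p.2 * |p.1|) := by
      rw [← ENNReal.ofReal_mul (by positivity), Real.exp_neg]
      congr 1
      field_simp
    have h3 : ENNReal.ofReal (Real.exp (-p.2) * |p.1|⁻¹) * ENNReal.ofReal |p.1|
        = ENNReal.ofReal (Real.exp (-p.2)) := by
      rw [← ENNReal.ofReal_mul (by positivity)]
      congr 1
      field_simp
    rw [Pi.mul_apply, ← h2, mul_assoc, h, ← mul_assoc, h3]
  rw [e0, e1, lintegral_haarL, Measure.volume_eq_prod, lintegral_prod_symm _ (by
      refine Measurable.aemeasurable (Measurable.mul ?_ (hF.enorm.pow_const 2))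
      fun_prop), lintegral_prod_symm _ (by
      have := hf.measurable
      fun_prop)]
  refine lintegral_congr fun r => ?_
  have hfr : Continuous fun x => f (x, r) := by fun_prop
  have hsr : HasCompactSupport fun x => f (x, r) := by
    refine HasCompactSupport.intro (hs.isCompact.image continuous_fst) fun x hx => ?_
    exact image_eq_zero_of_notMem_tsupport fun h => hx ⟨_, h, rfl⟩
  dsimp only
  rw [lintegral_const_mul' _ _ ENNReal.ofReal_ne_top, lintegral_const_mul' _ _ ENNReal.ofReal_ne_top,
    ← lintegral_waveFT (hfr.integrable_of_hasCompactSupport hsr)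
      (hfr.memLp_of_hasCompactSupport hsr)]
  congr 1
  exact lintegral_neg_eq_self (fun x => ‖waveFT (fun x => f (x, r)) x‖ₑ ^ 2)

theorem memLp_haarL (hf : Continuous f) (hs : HasCompactSupport f) : MemLp f 2 haarL :=
  hf.memLp_of_hasCompactSupport hs

theorem memLp_packetWave (hf : Continuous f) (hs : HasCompactSupport f) (s : ℤˣ) :
    MemLp (packetWave f s) 2 volume := by
  refine memLp_two_of_lintegral_ne_top (measurable_packetWave hf hs s).aestronglyMeasurable ?_
  rw [lintegral_packetWave hf hs, lintegral_enorm_sq_eq]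
  exact ENNReal.pow_ne_top (memLp_haarL hf hs).2.ne

theorem integral_haarL (F : ℝ × ℝ → ℂ) :
    ∫ g, F g ∂haarL = ∫ g : ℝ × ℝ, (Real.exp (-g.2) : ℂ) * F g := by
  rw [haarL, integral_withDensity_eq_integral_toReal_smul (by fun_prop)
    (Eventually.of_forall fun _ => ENNReal.ofReal_lt_top)]
  simp_rw [ENNReal.toReal_ofReal (Real.exp_pos _).le, Complex.real_smul]

theorem integrable_haarL {F : ℝ × ℝ → ℂ} (h : Integrable F haarL) :
    Integrable fun g : ℝ × ℝ => (Real.exp (-g.2) : ℂ) * F g := by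
  rw [haarL, integrable_withDensity_iff_integrable_smul' (by fun_prop)
    (Eventually.of_forall fun _ => ENNReal.ofReal_lt_top)] at h
  simpa only [ENNReal.toReal_ofReal (Real.exp_pos _).le, Complex.real_smul] using h

theorem conj_waveFT (h : ℝ → ℂ) (x : ℝ) :
    conj (waveFT h x) = waveFT (fun u => conj (h u)) (-x) := by
  simp only [waveFT, map_mul, Complex.conj_ofReal, ← integral_conj, ← Complex.exp_conj,
    Complex.conj_I, map_ofNat, Complex.ofReal_neg, mul_neg, neg_mul]

/-- The Fourier transform is symmetric for the bilinear pairing. -/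
theorem integral_mul_waveFT {h k : ℝ → ℂ} (h1 : Integrable h) (k1 : Integrable k) :
    ∫ x, h x * waveFT k (-x) = ∫ u, k u * waveFT h (-u) := by
  have hi : Integrable (Function.uncurry fun x u : ℝ =>
      h x * k u * Complex.exp (-(2 * Complex.I * x * u))) (volume.prod volume) := by
    refine (h1.mul_prod k1).mono ?_ (Eventually.of_forall fun z => ?_)
    · refine (h1.mul_prod k1).aestronglyMeasurable.mul (Continuous.aestronglyMeasurable ?_)
      fun_prop
    · simp only [Function.uncurry_def, norm_mul, Complex.norm_exp]
      simp
  have := integral_integral_swap hi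
  simp only [waveFT, mul_left_comm (h _), mul_left_comm (k _), integral_const_mul]
  congr 1
  refine Eq.trans ?_ (this.trans ?_)
  · refine integral_congr_ae (Eventually.of_forall fun x => ?_)
    simp only [← integral_const_mul]
    refine integral_congr_ae (Eventually.of_forall fun u => ?_)
    simp only [mul_assoc]
    congr 3
    push_cast; ring
  · refine integral_congr_ae (Eventually.of_forall fun x => ?_)
    simp only [← integral_const_mul]
    refine integral_congr_ae (Eventually.of_forall fun u => ?_)
    simp only
    rw [mul_comm (h u), mul_assoc]
    congr 3
    push_cast; ring

/-- For each `r` the symmetry of the Fourier transform moves it from the slice of `Ψ` onto `f(·,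
r)`; the orbit coordinates then turn the integral over `(u, r)` into one over the quadrants. Both
applications of Fubini rest on products of `L²` functions being integrable. -/
theorem packet_haarL (hf : Continuous f) (hs : HasCompactSupport f) (s : ℤˣ)
    (Ψ : 𝓢(ℝ × ℝ, ℂ)) : packet haarL f s Ψ = ∫ p, conj (yWave Ψ p) * packetWave f s p := by
  have hne : ∀ᵐ p : ℝ × ℝ, p.1 ≠ 0 :=
    Measure.quasiMeasurePreserving_fst.ae (Measure.ae_ne volume (0 : ℝ))
  set G : ℝ × ℝ → ℂ := fun p => conj (yWave Ψ p) * packetWave f s p with hG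
  set H : ℝ × ℝ → ℂ := fun p => conj (orbitSlice s Ψ p.2 p.1) * paramFT f p with hH
  have hGi : Integrable G (volume.restrict (quadrants s)) := by
    have := (integrable_mul_of_memLp_two (memLp_packetWave hf hs s) (memLp_yWave Ψ)).restrict
      (s := quadrants s)
    refine this.congr (Eventually.of_forall fun p => mul_comm _ _)
  have hcongr : (fun p : ℝ × ℝ => ((Real.exp p.2 * |p.1| : ℝ) : ℂ) * G (orbitMap s p)) =ᵐ[volume] H := by
    filter_upwards [hne] with p hp
    have h := packetWave_orbitMap f s hp p.2
    simp only [hG, hH, orbitSlice, map_mul, Complex.conj_ofReal]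
    rw [mul_left_comm, h]
    ring
  rw [← map_orbitMap] at hGi
  have hGi' := hGi.comp_measurable (continuous_orbitMap s).measurable
  have hHi : Integrable H := by
    rw [orbitMeasure, integrable_withDensity_iff_integrable_smul' (by fun_prop)
      (Eventually.of_forall fun _ => ENNReal.ofReal_lt_top)] at hGi'
    refine hGi'.congr (Filter.EventuallyEq.trans (Eventually.of_forall fun p => ?_) hcongr)
    dsimp only
    rw [ENNReal.toReal_ofReal (by positivity), Complex.real_smul]; rfl
  have e1 : ∫ p, G p = ∫ p, H p := by
    have : ∫ p, G p = ∫ p in quadrants s, G p := by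
      refine (setIntegral_eq_integral_of_forall_compl_eq_zero fun p hp => ?_).symm
      simp only [hG, packetWave, indicator_of_notMem hp, mul_zero]
    rw [this, ← map_orbitMap, integral_map (continuous_orbitMap s).measurable.aemeasurable
      hGi.aestronglyMeasurable, orbitMeasure, integral_withDensity_eq_integral_toReal_smul
      (by fun_prop) (Eventually.of_forall fun _ => ENNReal.ofReal_lt_top)]
    refine integral_congr_ae (Filter.EventuallyEq.trans (Eventually.of_forall fun p => ?_) hcongr)
    simp only
    rw [ENNReal.toReal_ofReal (by positivity), Complex.real_smul]
  have hLi := integrable_haarL (integrable_mul_of_memLp_two (memLp_haarL hf hs) (memLp_amp s Ψ))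
  rw [packet, integral_haarL, e1]
  rw [Measure.volume_eq_prod] at hLi hHi ⊢
  rw [integral_prod_symm _ hLi, integral_prod_symm _ hHi]
  refine integral_congr_ae (Eventually.of_forall fun r => ?_)
  have hfr : Continuous fun x => f (x, r) := by fun_prop
  have hsr : HasCompactSupport fun x => f (x, r) := by
    refine HasCompactSupport.intro (hs.isCompact.image continuous_fst) fun x hx => ?_
    exact image_eq_zero_of_notMem_tsupport fun h => hx ⟨_, h, rfl⟩
  have hsl : Integrable fun u => conj (orbitSlice s Ψ r u) :=
    LinearIsometryEquiv.integrable_comp_iff Complex.conjLIE |>.2 (integrable_orbitSlice s Ψ r)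
  refine Eq.trans ?_ (integral_mul_waveFT (hfr.integrable_of_hasCompactSupport hsr) hsl)
  refine integral_congr_ae (Eventually.of_forall fun x => ?_)
  have hE : ((Real.exp (-r) : ℝ) : ℂ) * ((Real.exp r : ℝ) : ℂ) = 1 := by
    rw [← Complex.ofReal_mul, ← Real.exp_add]; simp
  simp only [amp_eq, map_mul, Complex.conj_ofReal, conj_waveFT]
  linear_combination (f (x, r) * waveFT (fun u => conj (orbitSlice s Ψ r u)) (-x)) * hE

end

section

/-! ### The orthogonality relation -/

variable {f : ℝ × ℝ → ℂ}

theorem isOpen_quadrants (s : ℤˣ) : IsOpen (quadrants s) :=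
  isOpen_lt continuous_const (by fun_prop)

/-- The jump of the indicator lies on the axes: off them a point is either in the open quadrants,
where the formula is continuous, or in the opposite open quadrants, where the function vanishes. -/
theorem continuousOn_packetWave (hf : Continuous f) (hs : HasCompactSupport f) (s : ℤˣ) :
    ContinuousOn (packetWave f s) {p | p.1 * p.2 ≠ 0} := by
  intro p hp
  have hp0 : p.1 * p.2 ≠ 0 := hp
  have hp1 : p.1 ≠ 0 := left_ne_zero_of_mul hp0
  have hp2 : p.2 ≠ 0 := right_ne_zero_of_mul hp0
  refine ContinuousAt.continuousWithinAt ?_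
  by_cases h : p ∈ quadrants s
  · have hc := (continuous_paramFT hf hs).continuousAt
      (x := (p.1, Real.log |p.2 / p.1|))
    have hl : ContinuousAt (fun q : ℝ × ℝ => (q.1, Real.log |q.2 / q.1|)) p :=
      continuousAt_fst.prodMk (ContinuousAt.log (continuousAt_snd.div continuousAt_fst hp1).abs
        (abs_ne_zero.2 (div_ne_zero hp2 hp1)))
    have hw : ContinuousAt (fun q : ℝ × ℝ => ((√|q.1| / |q.2| : ℝ) : ℂ)) p := by
      refine Complex.continuous_ofReal.continuousAt.comp ?_
      exact (continuousAt_fst.abs.sqrt).div continuousAt_snd.abs (abs_ne_zero.2 hp2)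
    refine (hw.mul (ContinuousAt.comp (f := fun q : ℝ × ℝ => (q.1, Real.log |q.2 / q.1|))
      hc hl)).congr ?_
    filter_upwards [(isOpen_quadrants s).mem_nhds h] with q hq
    rw [packetWave, indicator_of_mem hq]; rfl
  · have h' : p ∈ {q : ℝ × ℝ | ((s : ℤ) : ℝ) * (q.1 * q.2) < 0} := by
      have hs0 : ((s : ℤ) : ℝ) ≠ 0 := by exact_mod_cast s.ne_zero
      exact lt_of_le_of_ne (not_lt.1 h) (mul_ne_zero hs0 hp0)
    have ho : IsOpen {q : ℝ × ℝ | ((s : ℤ) : ℝ) * (q.1 * q.2) < 0} :=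
      isOpen_lt (by fun_prop) continuous_const
    refine (continuousAt_const (y := (0 : ℂ))).congr ?_
    filter_upwards [ho.mem_nhds h'] with q hq
    have hq' : q ∉ quadrants s := fun h => lt_asymm (show _ < _ from h) (show _ < _ from hq)
    rw [packetWave, indicator_of_notMem hq']

/-- The line `y' = s y` is the orbit with `r = 0`, so `f` is evaluated at `r = 0`; for the other
sign the line misses the quadrants altogether. -/
theorem packetWave_line (f : ℝ × ℝ → ℂ) (s s' : ℤˣ) {y : ℝ} (hy : y ≠ 0) :
    (√|y| : ℂ) * packetWave f s' (y, ((s : ℤ) : ℝ) * y) =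
      if s = s' then waveFT (fun x => f (x, 0)) (-y) else 0 := by
  split_ifs with h
  · subst h
    have h := packetWave_orbitMap f s hy 0
    have hsq : (√|y| : ℂ) * (√|y| : ℂ) = ((|y| : ℝ) : ℂ) := by
      rw [← Complex.ofReal_mul, Real.mul_self_sqrt (abs_nonneg _)]
    have hne : (√|y| : ℂ) ≠ 0 := by
      rw [Complex.ofReal_ne_zero, Real.sqrt_ne_zero']; exact abs_pos.2 hy
    simp only [orbitMap, Real.exp_zero, one_mul] at h
    rw [← hsq, mul_assoc] at h
    exact mul_left_cancel₀ hne h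
  · rw [packetWave, indicator_of_notMem, mul_zero]
    have hs : ((s' : ℤ) : ℝ) * ((s : ℤ) : ℝ) = -1 := by
      rcases Int.units_eq_one_or s with rfl | rfl <;>
        rcases Int.units_eq_one_or s' with rfl | rfl <;> simp at h ⊢
    intro hm
    have hm' : 0 < ((s' : ℤ) : ℝ) * (y * (((s : ℤ) : ℝ) * y)) := hm
    nlinarith [sq_nonneg y]

theorem waveFT_neg_eq (h : ℝ → ℂ) : (fun y => waveFT h (-y)) =
    fun y => ((√Real.pi)⁻¹ : ℝ) * FourierTransform.fourier h (y * Real.pi⁻¹) := by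
  funext y
  rw [waveFT_eq, neg_mul_neg]

theorem integrable_waveFT (h : 𝓢(ℝ, ℂ)) : Integrable fun y => waveFT h (-y) := by
  rw [waveFT_neg_eq, ← SchwartzMap.fourier_coe]
  exact (((FourierTransform.fourier h).integrable (μ := volume)).comp_mul_right'
    (inv_ne_zero Real.pi_ne_zero)).const_mul _

theorem integral_waveFT (h : 𝓢(ℝ, ℂ)) :
    ((√Real.pi)⁻¹ : ℝ) * ∫ y, waveFT h (-y) = h 0 := by
  have hinv : ∫ y, (FourierTransform.fourier h) y = h 0 := by
    have := DFunLike.congr_fun (FourierTransform.fourierInv_fourier_eq (F := 𝓢(ℝ, ℂ)) h) 0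
    rw [← this, SchwartzMap.fourierInv_coe, Real.fourierInv_eq']
    simp
  have hs : ((√Real.pi : ℝ) : ℂ) ^ 2 = Real.pi := by
    exact_mod_cast Real.sq_sqrt Real.pi_pos.le
  have hs0 : ((√Real.pi : ℝ) : ℂ) ≠ 0 := by
    exact_mod_cast (Real.sqrt_pos.2 Real.pi_pos).ne'
  rw [waveFT_neg_eq, integral_const_mul, ← SchwartzMap.fourier_coe,
    Measure.integral_comp_mul_right (fun y => (FourierTransform.fourier h) y), hinv, inv_inv,
    abs_of_pos Real.pi_pos, Complex.real_smul, ← hs]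
  push_cast
  field_simp

/-- The orthogonality relation is stated with `dx dr`. The factor `e^r` that converts it to Haar
measure equals `1` at `r = 0`, so it does not affect the pointer value. -/
theorem packet_volume (f : ℝ × ℝ → ℂ) (s : ℤˣ) (Ψ : 𝓢(ℝ × ℝ, ℂ)) :
    packet volume f s Ψ = packet haarL (fun g => (Real.exp g.2 : ℂ) * f g) s Ψ := by
  rw [packet, packet, integral_haarL]
  refine integral_congr_ae (Eventually.of_forall fun g => ?_)
  have hE : ((Real.exp (-g.2) : ℝ) : ℂ) * ((Real.exp g.2 : ℝ) : ℂ) = 1 := by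
    rw [← Complex.ofReal_mul, ← Real.exp_add]; simp
  linear_combination -(f g * conj (amp s g Ψ)) * hE

theorem hasPointerValue_packet (hf : IsTest f) (s s' : ℤˣ) :
    HasPointerValue s (packet volume f s') (if s = s' then f (0, 0) else 0) := by
  have hFc : Continuous fun g : ℝ × ℝ => (Real.exp g.2 : ℂ) * f g := by
    have := hf.contDiff.continuous
    fun_prop
  have hFs : HasCompactSupport fun g : ℝ × ℝ => (Real.exp g.2 : ℂ) * f g := hf.compact.mul_left
  have hc : ContDiff ℝ ∞ fun x : ℝ => f (x, 0) := hf.contDiff.comp (by fun_prop)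
  have hcs : HasCompactSupport fun x : ℝ => f (x, 0) := by
    refine HasCompactSupport.intro (hf.compact.isCompact.image continuous_fst) fun x hx => ?_
    exact image_eq_zero_of_notMem_tsupport fun h => hx ⟨_, h, rfl⟩
  set h : 𝓢(ℝ, ℂ) := hcs.toSchwartzMap hc with hh
  have hha : ∀ x, h x = f (x, 0) := fun x => rfl
  have hae : (fun y : ℝ => (√|y| : ℂ) *
      packetWave (fun g => (Real.exp g.2 : ℂ) * f g) s' (y, ((s : ℤ) : ℝ) * y)) =ᵐ[volume]
      fun y => if s = s' then waveFT h (-y) else 0 := by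
    filter_upwards [Measure.ae_ne volume (0 : ℝ)] with y hy
    rw [packetWave_line _ _ _ hy]
    simp only [Real.exp_zero, Complex.ofReal_one, one_mul]
    rfl
  refine ⟨packetWave (fun g => (Real.exp g.2 : ℂ) * f g) s', memLp_packetWave hFc hFs s',
    continuousOn_packetWave hFc hFs s', fun Ψ => ?_, ?_, ?_⟩
  · rw [packet_volume, packet_haarL hFc hFs]
  · rw [integrable_congr hae]
    split_ifs
    · exact integrable_waveFT h
    · exact integrable_zero _ _ _
  · rw [pointerY, integral_congr_ae hae]
    split_ifs
    · rw [integral_waveFT, hha]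
    · simp

end

/-! ### Multiplication by indicator functions -/

section Restriction

variable {α : Type*} [MeasurableSpace α] {μ : Measure α}

open Classical in
/-- Multiplication by the indicator function of a measurable set on `L²` (and `0` for a set which
is not measurable). -/
noncomputable def restrictL2 (μ : Measure α) (B : Set α) : Lp ℂ 2 μ →L[ℂ] Lp ℂ 2 μ :=
  if hB : MeasurableSet B then
    LinearMap.mkContinuous
      { toFun := fun w => ((Lp.memLp w).indicator hB).toLp _
        map_add' := fun w z => by
          rw [← MemLp.toLp_add, MemLp.toLp_eq_toLp_iff]
          filter_upwards [Lp.coeFn_add w z] with a ha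
          simp only [indicator, Pi.add_apply]
          split_ifs
          · rw [ha]; rfl
          · simp
        map_smul' := fun c w => by
          rw [RingHom.id_apply, ← MemLp.toLp_const_smul, MemLp.toLp_eq_toLp_iff]
          filter_upwards [Lp.coeFn_smul c w] with a ha
          simp only [indicator, Pi.smul_apply]
          split_ifs
          · rw [ha]; rfl
          · simp } 1
      (fun w => by
        rw [one_mul]
        refine Lp.norm_le_norm_of_ae_le ?_
        filter_upwards [((Lp.memLp w).indicator hB).coeFn_toLp] with a ha
        change ‖(((Lp.memLp w).indicator hB).toLp _ : Lp ℂ 2 μ) a‖ ≤ _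
        rw [ha]
        exact norm_indicator_le_norm_self _ _)
  else 0

variable {B C : Set α}

theorem coeFn_restrictL2 (hB : MeasurableSet B) (w : Lp ℂ 2 μ) :
    restrictL2 μ B w =ᵐ[μ] B.indicator w := by
  rw [restrictL2, dif_pos hB]
  exact ((Lp.memLp w).indicator hB).coeFn_toLp

theorem restrictL2_univ : restrictL2 μ univ = 1 := by
  ext1 w
  apply Lp.ext
  filter_upwards [coeFn_restrictL2 MeasurableSet.univ w] with a ha
  rw [ha, indicator_univ]; rfl

theorem restrictL2_mul (hB : MeasurableSet B) (hC : MeasurableSet C) :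
    restrictL2 μ B * restrictL2 μ C = restrictL2 μ (B ∩ C) := by
  ext1 w
  apply Lp.ext
  filter_upwards [coeFn_restrictL2 hB (restrictL2 μ C w), coeFn_restrictL2 hC w,
    coeFn_restrictL2 (hB.inter hC) w] with a h1 h2 h3
  change restrictL2 μ B (restrictL2 μ C w) a = _
  rw [h1, h3, ← indicator_indicator]
  simp only [indicator] at h2 ⊢
  split_ifs with h h'
  · rw [h2, if_pos h']
  · rw [h2, if_neg h']
  · rfl

theorem inner_restrictL2 (hB : MeasurableSet B) (z w : Lp ℂ 2 μ) :
    ⟪z, restrictL2 μ B w⟫_ℂ = ∫ a in B, conj (z a) * w a ∂μ := by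
  rw [L2.inner_def, ← integral_indicator hB]
  refine integral_congr_ae ?_
  filter_upwards [coeFn_restrictL2 hB w] with a ha
  rw [ha, RCLike.inner_apply, mul_comm]
  simp only [indicator]
  split_ifs <;> simp

theorem adjoint_restrictL2 (hB : MeasurableSet B) :
    ContinuousLinearMap.adjoint (restrictL2 μ B) = restrictL2 μ B := by
  refine ((ContinuousLinearMap.eq_adjoint_iff _ _).2 fun z w => ?_).symm
  rw [← inner_conj_symm, inner_restrictL2 hB, inner_restrictL2 hB, ← integral_conj]
  refine integral_congr_ae (Eventually.of_forall fun a => ?_)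
  simp [mul_comm]

theorem norm_restrictL2_sq (hB : MeasurableSet B) (w : Lp ℂ 2 μ) :
    ‖restrictL2 μ B w‖ ^ 2 = ∫ a in B, ‖w a‖ ^ 2 ∂μ := by
  have h : ⟪restrictL2 μ B w, restrictL2 μ B w⟫_ℂ = ⟪w, restrictL2 μ B w⟫_ℂ := by
    conv_lhs => rw [← adjoint_restrictL2 hB, ContinuousLinearMap.adjoint_inner_left,
      adjoint_restrictL2 hB, ← mul_apply_eq_comp, restrictL2_mul hB hB, inter_self]
  rw [inner_self_eq_norm_sq_to_K, inner_restrictL2 hB] at h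
  have e : ∫ a in B, conj (w a) * w a ∂μ = ((∫ a in B, ‖w a‖ ^ 2 ∂μ : ℝ) : ℂ) := by
    rw [← integral_complex_ofReal]
    refine integral_congr_ae (Eventually.of_forall fun a => ?_)
    simp only [RCLike.conj_mul]
    push_cast; rfl
  rw [e] at h
  exact Complex.ofReal_injective (by rw [← h]; push_cast; rfl)

/-- The squared distance between a partial sum and the limit is a tail of `∫ ‖w‖²`, so countable
additivity of the integral gives strong convergence. -/
theorem hasSum_restrictL2 {B : ℕ → Set α} (hB : ∀ n, MeasurableSet (B n))
    (hd : Pairwise (Function.onFun Disjoint B)) (w : Lp ℂ 2 μ) :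
    HasSum (fun n => restrictL2 μ (B n) w) (restrictL2 μ (⋃ n, B n) w) := by
  have hU := MeasurableSet.iUnion hB
  have hint : Integrable (fun a => ‖w a‖ ^ 2) μ := (Lp.memLp w).integrable_norm_pow (by norm_num)
  have hs := hasSum_integral_iUnion hB hd hint.integrableOn
  have key : ∀ F : Finset ℕ, ‖∑ n ∈ F, restrictL2 μ (B n) w - restrictL2 μ (⋃ n, B n) w‖ ^ 2 =
      ∫ a in ⋃ n, B n, ‖w a‖ ^ 2 ∂μ - ∑ n ∈ F, ∫ a in B n, ‖w a‖ ^ 2 ∂μ := by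
    intro F
    have hF : MeasurableSet (⋃ n ∈ F, B n) := F.measurableSet_biUnion fun n _ => hB n
    have e1 : ∑ n ∈ F, restrictL2 μ (B n) w - restrictL2 μ (⋃ n, B n) w =
        - restrictL2 μ ((⋃ n, B n) \ ⋃ n ∈ F, B n) w := by
      apply Lp.ext
      have hall : ∀ᵐ a ∂μ, ∀ n, restrictL2 μ (B n) w a = (B n).indicator w a :=
        ae_all_iff.2 fun n => coeFn_restrictL2 (hB n) w
      have hsum : ⇑(∑ n ∈ F, restrictL2 μ (B n) w) =ᵐ[μ] ∑ n ∈ F, ⇑(restrictL2 μ (B n) w) :=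
        Lp.coeFn_finsetSum _ _
      filter_upwards [Lp.coeFn_sub (∑ n ∈ F, restrictL2 μ (B n) w) (restrictL2 μ (⋃ n, B n) w),
        Lp.coeFn_neg (restrictL2 μ ((⋃ n, B n) \ ⋃ n ∈ F, B n) w), hsum, hall,
        coeFn_restrictL2 hU w, coeFn_restrictL2 (hU.diff hF) w] with a h1 h2 h3 h4 h5 h6
      have hi := congrFun (Finset.indicator_biUnion F B (f := (w : α → ℂ))
        (fun i _ j _ hij => hd hij)) a
      have hi' := congrFun (indicator_sdiff (f := (w : α → ℂ))
        (show (⋃ n ∈ F, B n) ⊆ ⋃ n, B n from iUnion₂_subset fun n _ => subset_iUnion B n)) a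
      rw [h1, h2, Pi.sub_apply, Pi.neg_apply, h3, h5, h6, hi', Finset.sum_apply, Pi.sub_apply, hi]
      simp only [h4]
      ring
    rw [e1, norm_neg, norm_restrictL2_sq (hU.diff hF), setIntegral_sdiff hF hint.integrableOn
      (iUnion₂_subset fun n _ => subset_iUnion B n),
      integral_biUnion_finset F (fun n _ => hB n) (fun i _ j _ hij => hd hij)
        (fun n _ => hint.integrableOn)]
  have ht : Tendsto (fun F : Finset ℕ => ‖∑ n ∈ F, restrictL2 μ (B n) w -
      restrictL2 μ (⋃ n, B n) w‖ ^ 2) atTop (𝓝 0) := by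
    simp_rw [key]
    have := hs.const_sub (∫ a in ⋃ n, B n, ‖w a‖ ^ 2 ∂μ)
    rwa [sub_self] at this
  have ht' := ht.sqrt
  simp only [Real.sqrt_zero, Real.sqrt_sq (norm_nonneg _)] at ht'
  exact tendsto_iff_norm_sub_tendsto_zero.2 ht'

end Restriction

/-! ### Observables diagonalized by a direct sum of `L²` spaces -/

section Diagonal

variable {ι α : Type*} [Fintype ι] [MeasurableSpace α] {μ : Measure α}
  {H : Type*} [NormedAddCommGroup H] [InnerProductSpace ℂ H] [CompleteSpace H]

/-- The multiplication operators by indicator functions on a sum of copies of `L²`, transported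
by a map with components `J i`. -/
noncomputable def diagonalPOVM (J : ι → H →L[ℂ] Lp ℂ 2 μ) (B : Set α) : H →L[ℂ] H :=
  ∑ i, ContinuousLinearMap.adjoint (J i) ∘L restrictL2 μ B ∘L J i

variable {J : ι → H →L[ℂ] Lp ℂ 2 μ}

theorem inner_diagonalPOVM {B : Set α} (hB : MeasurableSet B) (v w : H) :
    ⟪v, diagonalPOVM J B w⟫_ℂ = ∑ i, ∫ a in B, conj (J i v a) * J i w a ∂μ := by
  rw [diagonalPOVM, sum_apply, inner_sum]
  refine Finset.sum_congr rfl fun i _ => ?_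
  rw [ContinuousLinearMap.comp_apply, ContinuousLinearMap.comp_apply,
    ContinuousLinearMap.adjoint_inner_right, inner_restrictL2 hB]

theorem diagonalPOVM_mul [DecidableEq ι]
    (horth : ∀ i j w, J i (ContinuousLinearMap.adjoint (J j) w) = if i = j then w else 0)
    {B C : Set α} (hB : MeasurableSet B) (hC : MeasurableSet C) :
    diagonalPOVM J B * diagonalPOVM J C = diagonalPOVM J (B ∩ C) := by
  ext1 v
  simp only [diagonalPOVM, mul_apply_eq_comp, sum_apply,
    ContinuousLinearMap.comp_apply, map_sum, horth]
  refine Finset.sum_congr rfl fun i _ => ?_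
  rw [← restrictL2_mul hB hC, Finset.sum_eq_single i]
  · rw [if_pos rfl]; rfl
  · intro j _ hj
    rw [if_neg hj]; simp
  · simp

theorem diagonalPOVM_selfAdjoint {B : Set α} (hB : MeasurableSet B) :
    IsSelfAdjoint (diagonalPOVM J B) := by
  rw [ContinuousLinearMap.isSelfAdjoint_iff', diagonalPOVM, map_sum]
  refine Finset.sum_congr rfl fun i _ => ?_
  rw [ContinuousLinearMap.adjoint_comp, ContinuousLinearMap.adjoint_comp,
    ContinuousLinearMap.adjoint_adjoint, adjoint_restrictL2 hB, ContinuousLinearMap.comp_assoc]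

/-- `hsum` says that the joint map `(J i)` is isometric and `horth` that it is onto; for a unitary,
multiplicativity and additivity of indicator functions pass to the transported operators. -/
theorem isOrthogonalPOVM_diagonal [DecidableEq ι]
    (hsum : ∑ i, ContinuousLinearMap.adjoint (J i) ∘L J i = 1)
    (horth : ∀ i j w, J i (ContinuousLinearMap.adjoint (J j) w) = if i = j then w else 0) :
    IsOrthogonalPOVM (diagonalPOVM J) := by
  have hP : ∀ B, MeasurableSet B → IsStarProjection (diagonalPOVM J B) := fun B hB =>
    ⟨by rw [IsIdempotentElem, diagonalPOVM_mul horth hB hB, inter_self],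
      diagonalPOVM_selfAdjoint hB⟩
  refine ⟨⟨fun B hB => ContinuousLinearMap.IsPositive.of_isStarProjection (hP B hB), ?_,
    fun B hB hd v => ?_⟩, hP, fun B C hB hC => diagonalPOVM_mul horth hB hC⟩
  · rw [← hsum, diagonalPOVM, restrictL2_univ]; rfl
  · simp only [diagonalPOVM, sum_apply, ContinuousLinearMap.comp_apply]
    exact hasSum_sum fun i _ =>
      (ContinuousLinearMap.adjoint (J i)).hasSum (hasSum_restrictL2 hB hd (J i v))

end Diagonal

/-! ### The amplitudes as operators on the two-mode Hilbert space -/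

/-- The Hilbert space of square-integrable functions on the affine group. -/
abbrev GroupL2 : Type := Lp ℂ 2 haarL

theorem yWave_add (Ψ Φ : 𝓢(ℝ × ℝ, ℂ)) (p : ℝ × ℝ) :
    yWave (Ψ + Φ : 𝓢(ℝ × ℝ, ℂ)) p = yWave Ψ p + yWave Φ p := by
  simp only [← yWaveS_apply]
  simp [yWaveS, toPlane, FourierTransform.fourier_add]

theorem yWave_smul (c : ℂ) (Ψ : 𝓢(ℝ × ℝ, ℂ)) (p : ℝ × ℝ) :
    yWave (c • Ψ : 𝓢(ℝ × ℝ, ℂ)) p = c * yWave Ψ p := by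
  simp only [← yWaveS_apply]
  simp [yWaveS, toPlane, FourierTransform.fourier_smul, mul_left_comm]

theorem integrable_mul_exp {h : ℝ → ℂ} (hh : Integrable h) (x : ℝ) :
    Integrable fun u : ℝ => h u * Complex.exp (2 * Complex.I * x * u) := by
  refine hh.mono (hh.aestronglyMeasurable.mul (Continuous.aestronglyMeasurable (by fun_prop)))
    (Eventually.of_forall fun u => ?_)
  simp [Complex.norm_exp]

theorem amp_add (s : ℤˣ) (g : ℝ × ℝ) (Ψ Φ : 𝓢(ℝ × ℝ, ℂ)) :
    amp s g (Ψ + Φ) = amp s g Ψ + amp s g Φ := by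
  rw [amp_eq, amp_eq, amp_eq, ← mul_add, waveFT, waveFT, waveFT, ← mul_add,
    ← integral_add (integrable_mul_exp (integrable_orbitSlice s Ψ g.2) _)
      (integrable_mul_exp (integrable_orbitSlice s Φ g.2) _)]
  simp only [orbitSlice, yWave_add, mul_add, add_mul]

theorem amp_smul (s : ℤˣ) (g : ℝ × ℝ) (c : ℂ) (Ψ : 𝓢(ℝ × ℝ, ℂ)) :
    amp s g (c • Ψ) = c * amp s g Ψ := by
  rw [amp_eq, amp_eq, waveFT, waveFT, mul_left_comm c, mul_left_comm c,
    ← integral_const_mul c]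
  refine congrArg _ (congrArg _ (integral_congr_ae (Eventually.of_forall fun u => ?_)))
  simp only [orbitSlice, yWave_smul]
  ring

/-- The amplitudes of a Schwartz function as a vector of `GroupL2`. -/
noncomputable def ampLin (s : ℤˣ) : 𝓢(ℝ × ℝ, ℂ) →ₗ[ℂ] GroupL2 where
  toFun Ψ := (memLp_amp s Ψ).toLp _
  map_add' Ψ Φ := by
    rw [← MemLp.toLp_add, MemLp.toLp_eq_toLp_iff]
    exact Eventually.of_forall fun g => amp_add s g Ψ Φ
  map_smul' c Ψ := by
    rw [RingHom.id_apply, ← MemLp.toLp_const_smul, MemLp.toLp_eq_toLp_iff]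
    exact Eventually.of_forall fun g => amp_smul s g c Ψ

theorem ofReal_norm_toLp_sq {α : Type*} [MeasurableSpace α] {μ : Measure α} {f : α → ℂ}
    (hf : MemLp f 2 μ) : ENNReal.ofReal (‖hf.toLp f‖ ^ 2) = ∫⁻ a, ‖f a‖ₑ ^ 2 ∂μ := by
  rw [ENNReal.ofReal_pow (norm_nonneg _), ofReal_norm, Lp.enorm_toLp, lintegral_enorm_sq_eq]

theorem sum_norm_ampLin_sq (Ψ : 𝓢(ℝ × ℝ, ℂ)) :
    ∑ s, ‖ampLin s Ψ‖ ^ 2 = ‖toTwoMode Ψ‖ ^ 2 := by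
  have h := sum_lintegral_amp Ψ
  have e : ∀ s, ENNReal.ofReal (‖ampLin s Ψ‖ ^ 2) = ∫⁻ g, ‖amp s g Ψ‖ₑ ^ 2 ∂haarL := fun s =>
    ofReal_norm_toLp_sq (memLp_amp s Ψ)
  simp_rw [← e] at h
  rw [← ENNReal.ofReal_sum_of_nonneg fun s _ => by positivity] at h
  exact (ENNReal.ofReal_eq_ofReal_iff (Finset.sum_nonneg fun s _ => by positivity)
    (by positivity)).1 h

theorem norm_ampLin_le (s : ℤˣ) (Ψ : 𝓢(ℝ × ℝ, ℂ)) : ‖ampLin s Ψ‖ ≤ ‖toTwoMode Ψ‖ := by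
  refine (sq_le_sq₀ (norm_nonneg _) (norm_nonneg _)).1 ?_
  rw [← sum_norm_ampLin_sq]
  exact Finset.single_le_sum (f := fun s => ‖ampLin s Ψ‖ ^ 2) (fun s _ => by positivity)
    (Finset.mem_univ s)

/-- The embedding of Schwartz functions into the two-mode Hilbert space. -/
noncomputable def schwartzIncl : 𝓢(ℝ × ℝ, ℂ) →ₗ[ℂ] TwoMode :=
  (SchwartzMap.toLpCLM ℂ ℂ 2 (volume : Measure (ℝ × ℝ))).toLinearMap

theorem schwartzIncl_apply (Ψ : 𝓢(ℝ × ℝ, ℂ)) : schwartzIncl Ψ = toTwoMode Ψ := rfl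

theorem denseRange_schwartzIncl : DenseRange schwartzIncl :=
  SchwartzMap.denseRange_toLpCLM (E := ℝ × ℝ) (F := ℂ) (p := 2) (μ := volume) (by norm_num)

/-- The amplitude `Ψ ↦ ⟨⟨Φ_s| U_g† ⊗ 1 |Ψ⟩⟩` as an operator on the two-mode Hilbert space. -/
noncomputable def ampOp (s : ℤˣ) : TwoMode →L[ℂ] GroupL2 :=
  (ampLin s).extendOfNorm schwartzIncl

theorem ampOp_toTwoMode (s : ℤˣ) (Ψ : 𝓢(ℝ × ℝ, ℂ)) : ampOp s (toTwoMode Ψ) = ampLin s Ψ :=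
  LinearMap.extendOfNorm_eq denseRange_schwartzIncl
    ⟨1, fun Ψ => by rw [one_mul]; exact norm_ampLin_le s Ψ⟩ Ψ

theorem coeFn_ampOp (s : ℤˣ) (Ψ : 𝓢(ℝ × ℝ, ℂ)) :
    ampOp s (toTwoMode Ψ) =ᵐ[haarL] fun g => amp s g Ψ := by
  rw [ampOp_toTwoMode]
  exact (memLp_amp s Ψ).coeFn_toLp

theorem sum_norm_ampOp_sq (v : TwoMode) : ∑ s, ‖ampOp s v‖ ^ 2 = ‖v‖ ^ 2 := by
  refine denseRange_schwartzIncl.induction_on v (isClosed_eq (by fun_prop) (by fun_prop)) fun Ψ => ?_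
  simp_rw [schwartzIncl_apply, ampOp_toTwoMode]
  exact sum_norm_ampLin_sq Ψ

/-! ### Packets as adjoint images, and unitarity of the amplitude map. -/

theorem eq_of_inner_schwartz {v w : TwoMode}
    (h : ∀ Ψ : 𝓢(ℝ × ℝ, ℂ), ⟪toTwoMode Ψ, v⟫_ℂ = ⟪toTwoMode Ψ, w⟫_ℂ) : v = w := by
  refine ext_inner_left ℂ fun z => ?_
  refine denseRange_schwartzIncl.induction_on z (isClosed_eq (by fun_prop) (by fun_prop)) h

theorem inner_adjoint_ampOp {f : ℝ × ℝ → ℂ} (hf : MemLp f 2 haarL) (s : ℤˣ) (Ψ : 𝓢(ℝ × ℝ, ℂ)) :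
    ⟪toTwoMode Ψ, ContinuousLinearMap.adjoint (ampOp s) (hf.toLp f)⟫_ℂ = packet haarL f s Ψ := by
  rw [ContinuousLinearMap.adjoint_inner_right, L2.inner_def, packet]
  refine integral_congr_ae ?_
  filter_upwards [coeFn_ampOp s Ψ, hf.coeFn_toLp] with g h1 h2
  rw [h1, h2, RCLike.inner_apply]

/-- Superposing the generalized vectors with weight `f` is the adjoint of taking amplitudes. This
gives existence of the packet, and density of Schwartz functions gives uniqueness. -/
theorem isPacket_iff {f : ℝ × ℝ → ℂ} (hf : MemLp f 2 haarL) (s : ℤˣ) (v : TwoMode) :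
    IsPacket f s v ↔ v = ContinuousLinearMap.adjoint (ampOp s) (hf.toLp f) := by
  constructor
  · intro h
    exact eq_of_inner_schwartz fun Ψ => by rw [h, inner_adjoint_ampOp]
  · rintro rfl Ψ
    exact inner_adjoint_ampOp hf s Ψ

theorem dense_testFunctions :
    Dense {w : GroupL2 | ∃ (f : ℝ × ℝ → ℂ) (hf : IsTest f),
      w = (memLp_haarL hf.contDiff.continuous hf.compact).toLp f} := by
  intro w
  refine (mem_closure_iff_nhds_basis Metric.nhds_basis_closedBall).2 fun ε hε => ?_
  obtain ⟨g, hg₁, hg₂, hg₃⟩ := MemLp.exist_eLpNorm_sub_le (p := 2) (by norm_num) (by norm_num)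
    (Lp.memLp w) hε
  have hg := memLp_haarL hg₂.continuous hg₁
  refine ⟨hg.toLp g, ⟨g, ⟨hg₂, hg₁⟩, rfl⟩, ?_⟩
  rw [Metric.mem_closedBall', Lp.dist_def]
  refine ENNReal.toReal_le_of_le_ofReal hε.le (le_trans (le_of_eq (eLpNorm_congr_ae ?_)) hg₃)
  filter_upwards [hg.coeFn_toLp] with a ha
  simp [ha]

/-- For a test function the adjoint image is the vector with wavefunction `packetWave f s`, whose
norm is known; density extends the equality to all of `GroupL2`. -/
theorem norm_adjoint_ampOp (s : ℤˣ) (w : GroupL2) :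
    ‖ContinuousLinearMap.adjoint (ampOp s) w‖ = ‖w‖ := by
  refine dense_testFunctions.induction ?_ (isClosed_eq (by fun_prop) (by fun_prop)) w
  rintro _ ⟨f, hf, rfl⟩
  have hfc := hf.contDiff.continuous
  have hm := memLp_haarL hfc hf.compact
  obtain ⟨v, hv, hn⟩ := exists_vector_of_yWave (memLp_packetWave hfc hf.compact s)
  have hp : IsPacket f s v := fun Ψ => by rw [hv, packet_haarL hfc hf.compact]
  rw [lintegral_packetWave hfc hf.compact, ← ofReal_norm_toLp_sq hm,
    ENNReal.ofReal_eq_ofReal_iff (by positivity) (by positivity)] at hn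
  rw [← (isPacket_iff hm s v).1 hp]
  exact (sq_eq_sq₀ (norm_nonneg _) (norm_nonneg _)).1 hn

theorem inner_map_map_of_norm_map {H K : Type*} [NormedAddCommGroup H] [InnerProductSpace ℂ H]
    [NormedAddCommGroup K] [InnerProductSpace ℂ K] (T : H →ₗ[ℂ] K) (h : ∀ v, ‖T v‖ = ‖v‖)
    (v w : H) : ⟪T v, T w⟫_ℂ = ⟪v, w⟫_ℂ :=
  (LinearIsometry.mk T h).inner_map_map v w

theorem sum_adjoint_comp_ampOp :
    ∑ s, ContinuousLinearMap.adjoint (ampOp s) ∘L ampOp s = 1 := by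
  have h : (∑ s, ContinuousLinearMap.adjoint (ampOp s) ∘L ampOp s).toLinearMap =
      (1 : TwoMode →L[ℂ] TwoMode).toLinearMap := by
    -- Over `ℂ` an operator is determined by its quadratic form, so the norm identity suffices.
    refine (ext_inner_map _ _).1 fun v => ?_
    change ⟪(∑ s, ContinuousLinearMap.adjoint (ampOp s) ∘L ampOp s) v, v⟫_ℂ = ⟪v, v⟫_ℂ
    rw [sum_apply, sum_inner]
    simp_rw [ContinuousLinearMap.comp_apply, ContinuousLinearMap.adjoint_inner_left,
      inner_self_eq_norm_sq_to_K]
    exact_mod_cast congrArg (fun r : ℝ => (r : ℂ)) (sum_norm_ampOp_sq v)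
  exact ContinuousLinearMap.coe_injective h

/-- On the diagonal, an isometric adjoint is inverted on the left by `ampOp t`. The component of
sign `t` then already carries the whole norm of the packet, so the squared norms, which add up to
it, leave nothing for the other sign. -/
theorem ampOp_adjoint (s t : ℤˣ) (w : GroupL2) :
    ampOp s (ContinuousLinearMap.adjoint (ampOp t) w) = if s = t then w else 0 := by
  have hdiag : ∀ w, ampOp t (ContinuousLinearMap.adjoint (ampOp t) w) = w := fun w => by
    refine ext_inner_left ℂ fun z => ?_
    rw [← ContinuousLinearMap.adjoint_inner_left]
    exact inner_map_map_of_norm_map (ContinuousLinearMap.adjoint (ampOp t)).toLinearMap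
      (norm_adjoint_ampOp t) z w
  split_ifs with h
  · rw [h, hdiag]
  · have hs := sum_norm_ampOp_sq (ContinuousLinearMap.adjoint (ampOp t) w)
    have hle : ‖ampOp s (ContinuousLinearMap.adjoint (ampOp t) w)‖ ^ 2 +
        ‖ampOp t (ContinuousLinearMap.adjoint (ampOp t) w)‖ ^ 2 ≤
        ∑ i, ‖ampOp i (ContinuousLinearMap.adjoint (ampOp t) w)‖ ^ 2 := by
      rw [← Finset.sum_pair (f := fun i =>
        ‖ampOp i (ContinuousLinearMap.adjoint (ampOp t) w)‖ ^ 2) h]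
      exact Finset.sum_le_sum_of_subset_of_nonneg (Finset.subset_univ _)
        fun _ _ _ => by positivity
    rw [hs, norm_adjoint_ampOp, hdiag] at hle
    have : ‖ampOp s (ContinuousLinearMap.adjoint (ampOp t) w)‖ ^ 2 = 0 :=
      le_antisymm (by linarith) (by positivity)
    exact norm_eq_zero.1 (pow_eq_zero_iff two_ne_zero |>.1 this)

/-- The observable `B ↦ ∫_B d_L g M(g)`. -/
noncomputable def affPOVM : Set (ℝ × ℝ) → TwoMode →L[ℂ] TwoMode := diagonalPOVM ampOp

theorem isOrthogonalPOVM_affPOVM : IsOrthogonalPOVM affPOVM :=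
  isOrthogonalPOVM_diagonal sum_adjoint_comp_ampOp ampOp_adjoint

theorem isGenerated_affPOVM : IsGenerated affPOVM := by
  intro B hB Ψ Ψ'
  have hi : ∀ s : ℤˣ, Integrable (fun g => conj (amp s g Ψ) * amp s g Ψ') haarL := fun s =>
    (integrable_mul_of_memLp_two (memLp_amp s Ψ') (memLp_amp s Ψ)).congr
      (Eventually.of_forall fun g => mul_comm _ _)
  refine ⟨(integrable_finsetSum _ fun s _ => hi s).integrableOn, ?_⟩
  rw [affPOVM, inner_diagonalPOVM hB]
  simp only [povmDensity]
  rw [integral_finsetSum _ fun s _ => (hi s).integrableOn]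
  refine Finset.sum_congr rfl fun s _ => setIntegral_congr_ae hB ?_
  filter_upwards [coeFn_ampOp s Ψ, coeFn_ampOp s Ψ'] with g h1 h2 _
  rw [h1, h2]

theorem IsGenerated.unique {E E' : Set (ℝ × ℝ) → TwoMode →L[ℂ] TwoMode} (h : IsGenerated E)
    (h' : IsGenerated E') {B : Set (ℝ × ℝ)} (hB : MeasurableSet B) : E' B = E B := by
  ext1 v
  refine denseRange_schwartzIncl.induction_on v (isClosed_eq (by fun_prop) (by fun_prop)) fun Ψ => ?_
  refine eq_of_inner_schwartz fun Φ => ?_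
  rw [schwartzIncl_apply, (h B hB Φ Ψ).2, (h' B hB Φ Ψ).2]

/-! ### Covariance -/

theorem affShift_affShift (g h q : ℝ × ℝ) : affShift h (affShift g q) = affShift (affMul g h) q := by
  have h1 : Real.exp (-(g.2 + h.2)) = Real.exp (-g.2) * Real.exp (-h.2) := by
    rw [← Real.exp_add]; ring_nf
  have h2 : Real.exp (-g.2) * Real.exp g.2 = 1 := by rw [← Real.exp_add]; simp
  ext
  · simp only [affShift, affMul, h1]
    linear_combination (Real.exp (-h.2) * h.1) * h2
  · rfl

theorem affAct₂_affAct₂ (g h : ℝ × ℝ) (Ψ : ℝ × ℝ → ℂ) :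
    affAct₂ g (affAct₂ h Ψ) = affAct₂ (affMul g h) Ψ := by
  funext q
  rw [affAct₂_apply, affAct₂_apply, affAct₂_apply, affShift_affShift, ← mul_assoc,
    ← Complex.ofReal_mul, ← Real.exp_add]
  congr 3
  simp only [affMul]
  ring_nf

theorem affMul_affInv_left (g h : ℝ × ℝ) : affMul (affInv g) (affMul g h) = h := by
  have h2 : Real.exp (-g.2) * Real.exp g.2 = 1 := by rw [← Real.exp_add]; simp
  ext
  · simp only [affInv, affMul]
    linear_combination h.1 * h2
  · simp [affInv, affMul]

theorem affMul_affInv_right (g h : ℝ × ℝ) : affMul g (affMul (affInv g) h) = h := by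
  have := affMul_affInv_left (affInv g) h
  rwa [affInv_affInv] at this

theorem affInv_affMul (g h : ℝ × ℝ) : affInv (affMul (affInv g) h) = affMul (affInv h) g := by
  have h1 : Real.exp (-(-g.2 + h.2)) * Real.exp (-g.2) = Real.exp (-h.2) := by
    rw [← Real.exp_add]; ring_nf
  ext
  · simp only [affInv, affMul]
    linear_combination (g.1 - h.1) * h1
  · simp only [affInv, affMul]; ring

/-- Left multiplication as a measurable equivalence. -/
noncomputable def affMulEquiv (g : ℝ × ℝ) : ℝ × ℝ ≃ᵐ ℝ × ℝ where
  toFun := affMul g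
  invFun := affMul (affInv g)
  left_inv := affMul_affInv_left g
  right_inv := affMul_affInv_right g
  measurable_toFun := by
    change Measurable (affMul g)
    unfold affMul; fun_prop
  measurable_invFun := by
    change Measurable (affMul (affInv g))
    unfold affMul; fun_prop

theorem map_affMul_volume (g : ℝ × ℝ) : Measure.map (affMul g) volume =
    ENNReal.ofReal (Real.exp (-g.2)) • (volume : Measure (ℝ × ℝ)) := by
  have e : affMul g = Prod.map (fun t : ℝ => g.1 + Real.exp g.2 * t) fun r : ℝ => g.2 + r := rfl
  have h1 : Measure.map (fun t : ℝ => g.1 + Real.exp g.2 * t) volume =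
      ENNReal.ofReal (Real.exp (-g.2)) • (volume : Measure ℝ) := by
    have : (fun t : ℝ => g.1 + Real.exp g.2 * t) =
        (fun t : ℝ => g.1 + t) ∘ fun t : ℝ => Real.exp g.2 * t := rfl
    rw [this, ← Measure.map_map (by fun_prop) (by fun_prop),
      Real.map_volume_mul_left (Real.exp_ne_zero _), Measure.map_smul,
      (measurePreserving_add_left volume g.1).map_eq, ← Real.exp_neg,
      abs_of_pos (Real.exp_pos _)]
  rw [e, Measure.volume_eq_prod, ← Measure.map_prod_map _ _ (by fun_prop) (by fun_prop), h1,
    (measurePreserving_add_left volume g.2).map_eq, Measure.prod_smul_left]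

/-- Left multiplication scales Lebesgue measure by `e^{-r}`, and the shift of the second coordinate
in the density `e^{-r}` compensates for it. -/
theorem measurePreserving_affMul (g : ℝ × ℝ) : MeasurePreserving (affMul g) haarL haarL := by
  have hm : Measurable (affMul g) := (affMulEquiv g).measurable
  refine ⟨hm, ?_⟩
  ext S hS
  rw [← lintegral_indicator_one hS, ← lintegral_indicator_one hS, lintegral_map
    (measurable_one.indicator hS) hm, lintegral_haarL, lintegral_haarL]
  have h := lintegral_map (μ := volume) (f := fun a : ℝ × ℝ =>
    ENNReal.ofReal (Real.exp (-a.2)) * S.indicator 1 a) (g := affMul g)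
    (Measurable.mul (by fun_prop) (measurable_one.indicator hS)) hm
  rw [map_affMul_volume, lintegral_smul_measure, smul_eq_mul] at h
  have e : ∀ a : ℝ × ℝ, ENNReal.ofReal (Real.exp (-a.2)) * S.indicator 1 (affMul g a) =
      ENNReal.ofReal (Real.exp g.2) * (ENNReal.ofReal (Real.exp (-(affMul g a).2)) *
        S.indicator 1 (affMul g a)) := by
    intro a
    rw [← mul_assoc, ← ENNReal.ofReal_mul (Real.exp_pos _).le, ← Real.exp_add]
    congr 3
    simp only [affMul]; ring
  simp_rw [e]
  rw [lintegral_const_mul' _ _ ENNReal.ofReal_ne_top, ← h, ← mul_assoc,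
    ← ENNReal.ofReal_mul (Real.exp_pos _).le, ← Real.exp_add]
  simp

/-- The linear part of `affShift`. -/
noncomputable def affScale (g : ℝ × ℝ) : (ℝ × ℝ) ≃L[ℝ] ℝ × ℝ :=
  (ContinuousLinearEquiv.smulLeft (Units.mk0 (Real.exp (-g.2)) (Real.exp_ne_zero _))).prodCongr
    (ContinuousLinearEquiv.refl ℝ ℝ)

/-- `U_{x,r} ⊗ 1` on Schwartz functions. -/
noncomputable def affSchwartz (g : ℝ × ℝ) (Ψ : 𝓢(ℝ × ℝ, ℂ)) : 𝓢(ℝ × ℝ, ℂ) :=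
  (Real.exp (-g.2 / 2) : ℂ) • SchwartzMap.compSubConstCLM ℂ (g.1, (0 : ℝ))
    (SchwartzMap.compCLMOfContinuousLinearEquiv ℂ (affScale g) Ψ)

theorem coe_affSchwartz (g : ℝ × ℝ) (Ψ : 𝓢(ℝ × ℝ, ℂ)) : ⇑(affSchwartz g Ψ) = affAct₂ g Ψ := by
  funext q
  have : affScale g (q - (g.1, 0)) = affShift g q := by
    ext
    · rfl
    · simp [affScale, affShift]
  rw [affAct₂_apply, ← this]
  rfl

theorem affU_toTwoMode (g : ℝ × ℝ) (Ψ : 𝓢(ℝ × ℝ, ℂ)) :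
    affU g (toTwoMode Ψ) = toTwoMode (affSchwartz g Ψ) := by
  apply Lp.ext
  have h1 := MemLp.coeFn_toLp (memLp_affAct₂ g (Lp.memLp (toTwoMode Ψ)))
  have h2 := affAct₂_congr g (Ψ.coeFn_toLp 2 volume)
  have h3 := (affSchwartz g Ψ).coeFn_toLp 2 volume
  rw [coe_affSchwartz] at h3
  exact (h1.trans h2).trans h3.symm

theorem amp_affSchwartz (s : ℤˣ) (g h : ℝ × ℝ) (Ψ : 𝓢(ℝ × ℝ, ℂ)) :
    amp s (affMul g h) (affSchwartz g Ψ) = amp s h Ψ := by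
  rw [amp, amp, coe_affSchwartz, affAct₂_affAct₂, ← affInv_affMul, affMul_affInv_left]

theorem povmDensity_affSchwartz (g h : ℝ × ℝ) (Ψ Ψ' : 𝓢(ℝ × ℝ, ℂ)) :
    povmDensity (affMul g h) (affSchwartz g Ψ) (affSchwartz g Ψ') = povmDensity h Ψ Ψ' := by
  simp only [povmDensity, amp_affSchwartz]

/-- The conjugated family has the same density as `affPOVM`, by invariance of the Haar measure and
of the amplitudes; operators generated by one density coincide. -/
theorem affU_symm_affPOVM_affU (g : ℝ × ℝ) {B : Set (ℝ × ℝ)} (hB : MeasurableSet B)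
    (v : TwoMode) : (affU g).symm (affPOVM (affMul g '' B) (affU g v)) = affPOVM B v := by
  have hgen : IsGenerated fun B => ((affU g).symm : TwoMode ≃L[ℂ] TwoMode).toContinuousLinearMap ∘L
      affPOVM (affMul g '' B) ∘L ((affU g : TwoMode ≃L[ℂ] TwoMode).toContinuousLinearMap) := by
    intro B hB Ψ Ψ'
    have hgB : MeasurableSet (affMul g '' B) := (affMulEquiv g).measurableSet_image.2 hB
    refine ⟨(isGenerated_affPOVM B hB Ψ Ψ').1, ?_⟩
    have h := (isGenerated_affPOVM _ hgB (affSchwartz g Ψ) (affSchwartz g Ψ')).2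
    rw [(measurePreserving_affMul g).setIntegral_image_emb (affMulEquiv g).measurableEmbedding] at h
    simp_rw [povmDensity_affSchwartz, ← affU_toTwoMode] at h
    rw [← h]
    exact ((affU g).inner_map_eq_flip _ _).symm
  exact DFunLike.congr_fun (isGenerated_affPOVM.unique hgen hB) v

theorem isCovariant_affPOVM : IsCovariant affPOVM := by
  intro g B hB v
  rw [← affU_symm_affPOVM_affU g hB, LinearIsometryEquiv.apply_symm_apply,
    LinearIsometryEquiv.apply_symm_apply]

/-! ### Perfect estimation -/

theorem inner_affPOVM_adjoint (s t : ℤˣ) (z w : GroupL2) (B : Set (ℝ × ℝ)) :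
    ⟪ContinuousLinearMap.adjoint (ampOp s) z,
      affPOVM B (ContinuousLinearMap.adjoint (ampOp t) w)⟫_ℂ =
      if s = t then ⟪z, restrictL2 haarL B w⟫_ℂ else 0 := by
  have e : affPOVM B (ContinuousLinearMap.adjoint (ampOp t) w) =
      ContinuousLinearMap.adjoint (ampOp t) (restrictL2 haarL B w) := by
    rw [affPOVM, diagonalPOVM, sum_apply]
    simp only [ContinuousLinearMap.comp_apply, ampOp_adjoint]
    rw [Finset.sum_eq_single t]
    · rw [if_pos rfl]
    · intro i _ hi
      rw [if_neg hi]; simp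
    · exact fun h => absurd (Finset.mem_univ t) h
  rw [e, ContinuousLinearMap.adjoint_inner_left, ampOp_adjoint]
  split_ifs <;> simp

theorem inner_packet {f f' : ℝ × ℝ → ℂ} (hf : MemLp f 2 haarL) (hf' : MemLp f' 2 haarL)
    {s s' : ℤˣ} {v v' : TwoMode} (hv : IsPacket f s v) (hv' : IsPacket f' s' v')
    {B : Set (ℝ × ℝ)} (hB : MeasurableSet B) :
    ⟪v, affPOVM B v'⟫_ℂ = if s = s' then ∫ g in B, conj (f g) * f' g ∂haarL else 0 := by
  rw [(isPacket_iff hf s v).1 hv, (isPacket_iff hf' s' v').1 hv', inner_affPOVM_adjoint,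
    inner_restrictL2 hB]
  congr 1
  refine setIntegral_congr_ae hB ?_
  filter_upwards [hf.coeFn_toLp, hf'.coeFn_toLp] with g h1 h2 _
  rw [h1, h2]

theorem IsTest.memLp {f : ℝ × ℝ → ℂ} (hf : IsTest f) : MemLp f 2 haarL :=
  memLp_haarL hf.contDiff.continuous hf.compact

theorem exists_isTest_norm_eq_one {N : Set (ℝ × ℝ)} (hN : N ∈ 𝓝 (0, 0)) :
    ∃ (f : ℝ × ℝ → ℂ) (hf : IsTest f), tsupport f ⊆ N ∧ ‖hf.memLp.toLp f‖ = 1 := by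
  obtain ⟨φ, hφN, hφc, hφd, -, hφ0⟩ := exists_contDiff_tsupport_subset (n := ⊤) hN
  have hts : tsupport (fun g => (φ g : ℂ)) ⊆ tsupport φ :=
    closure_mono fun g hg => by simpa using hg
  have hf : IsTest fun g => (φ g : ℂ) :=
    ⟨Complex.ofRealCLM.contDiff.comp hφd, hφc.comp_left Complex.ofReal_zero⟩
  set c : ℝ := ‖hf.memLp.toLp _‖ with hc
  have hc0 : c ≠ 0 := by
    intro h0
    have h1 : hf.memLp.toLp _ = 0 := norm_eq_zero.1 h0
    have h2 : (fun g => (φ g : ℂ)) =ᵐ[haarL] 0 := by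
      refine hf.memLp.coeFn_toLp.symm.trans ?_
      rw [h1]
      exact Lp.coeFn_zero ℂ 2 haarL
    -- The Haar density is everywhere positive, so a function null for `haarL` is null for Lebesgue
    -- measure; continuity then contradicts `φ (0, 0) = 1`.
    have hac : (volume : Measure (ℝ × ℝ)) ≪ haarL :=
      withDensity_absolutelyContinuous' (by fun_prop)
        (Eventually.of_forall fun g => (ENNReal.ofReal_pos.2 (Real.exp_pos _)).ne')
    have h3 := (Continuous.ae_eq_iff_eq volume hf.contDiff.continuous continuous_zero).1
      (hac.ae_le h2)
    have h4 := congrFun h3 (0, 0)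
    simp [hφ0] at h4
  have hf' : IsTest fun g => (c⁻¹ : ℂ) * (φ g : ℂ) :=
    ⟨contDiff_const.mul hf.contDiff, hf.compact.mul_left⟩
  refine ⟨_, hf', ?_, ?_⟩
  · exact (tsupport_mul_subset_right.trans hts).trans hφN
  · have : hf'.memLp.toLp _ = (c⁻¹ : ℂ) • hf.memLp.toLp _ := MemLp.toLp_const_smul (c⁻¹ : ℂ) hf.memLp
    rw [this, norm_smul, ← hc, norm_inv, Complex.norm_real, hc, norm_norm]
    exact inv_mul_cancel₀ hc0

theorem exists_perfect_packet (s : ℤˣ) {N : Set (ℝ × ℝ)} (hN : IsOpen N) (h0 : (0, 0) ∈ N) :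
    ∃ (f : ℝ × ℝ → ℂ) (v : TwoMode), IsTest f ∧ tsupport f ⊆ N ∧ IsPacket f s v ∧ ‖v‖ = 1 ∧
      ∀ g : ℝ × ℝ, ⟪affU g v, affPOVM (affMul g '' N) (affU g v)⟫_ℂ = 1 := by
  obtain ⟨f, hf, hfN, hn⟩ := exists_isTest_norm_eq_one (hN.mem_nhds h0)
  refine ⟨f, _, hf, hfN, (isPacket_iff hf.memLp s _).2 rfl, ?_, fun g => ?_⟩
  · rw [norm_adjoint_ampOp, hn]
  · have hres : restrictL2 haarL N (hf.memLp.toLp f) = hf.memLp.toLp f := by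
      apply Lp.ext
      filter_upwards [coeFn_restrictL2 hN.measurableSet (hf.memLp.toLp f), hf.memLp.coeFn_toLp]
        with a h1 h2
      rw [h1]
      by_cases ha : a ∈ N
      · rw [indicator_of_mem ha]
      · rw [indicator_of_notMem ha, h2, image_eq_zero_of_notMem_tsupport fun h => ha (hfN h)]
    rw [LinearIsometryEquiv.inner_map_eq_flip, affU_symm_affPOVM_affU g hN.measurableSet,
      inner_affPOVM_adjoint, if_pos rfl, hres, inner_self_eq_norm_sq_to_K, hn]
    simp

end AffineEstimation

theorem mainTheorem8 :
    -- orthogonality relation `⟨⟨Φ_s| U_{x,r} ⊗ 1 |Φ_{s'}⟩⟩ = δ(x) δ(r) δ_{s s'}`,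
    -- an identity of distributions in `(x, r)`
    (∀ (s s' : ℤˣ) (f : ℝ × ℝ → ℂ), AffineEstimation.IsTest f →
      AffineEstimation.HasPointerValue s (AffineEstimation.packet volume f s')
        (if s = s' then f (0, 0) else 0)) ∧
    -- smeared vectors `∫ d_L g f(g) U_g ⊗ 1 |Φ_s⟩⟩` lie in the Hilbert space
    (∀ (s : ℤˣ) (f : ℝ × ℝ → ℂ), AffineEstimation.IsTest f →
      ∃! v : AffineEstimation.TwoMode, AffineEstimation.IsPacket f s v) ∧
    ∃ E : Set (ℝ × ℝ) → AffineEstimation.TwoMode →L[ℂ] AffineEstimation.TwoMode,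
      -- the operators `E(B) = ∫_B d_L g M(g)` exist and are determined by the density `M(g)`
      AffineEstimation.IsGenerated E ∧
      (∀ E' : Set (ℝ × ℝ) → AffineEstimation.TwoMode →L[ℂ] AffineEstimation.TwoMode,
        AffineEstimation.IsGenerated E' → ∀ B, MeasurableSet B → E' B = E B) ∧
      -- they form a covariant, normalized and orthogonal POVM
      AffineEstimation.IsOrthogonalPOVM E ∧
      AffineEstimation.IsCovariant E ∧
      -- Dirac orthonormality, localized to a set of outcomes
      (∀ (s s' : ℤˣ) (f f' : ℝ × ℝ → ℂ), AffineEstimation.IsTest f → AffineEstimation.IsTest f' →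
        ∀ v v' : AffineEstimation.TwoMode,
          AffineEstimation.IsPacket f s v → AffineEstimation.IsPacket f' s' v' →
        ∀ B, MeasurableSet B →
          ⟪v, E B v'⟫_ℂ =
            if s = s' then ∫ g in B, conj (f g) * f' g ∂AffineEstimation.haarL else 0) ∧
      -- perfect estimation: arbitrarily precise detection of every `(x, r)`, with certainty
      (∀ (s : ℤˣ) (N : Set (ℝ × ℝ)), IsOpen N → (0, 0) ∈ N →
        ∃ (f : ℝ × ℝ → ℂ) (v : AffineEstimation.TwoMode),
          AffineEstimation.IsTest f ∧ tsupport f ⊆ N ∧ AffineEstimation.IsPacket f s v ∧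
          ‖v‖ = 1 ∧
          ∀ g : ℝ × ℝ,
            ⟪AffineEstimation.affU g v,
              E (AffineEstimation.affMul g '' N) (AffineEstimation.affU g v)⟫_ℂ = 1) := by
  open AffineEstimation in
  refine ⟨fun s s' f hf => hasPointerValue_packet hf s s', fun s f hf => ?_, affPOVM,
    isGenerated_affPOVM, fun E' hE' B hB => isGenerated_affPOVM.unique hE' hB,
    isOrthogonalPOVM_affPOVM, isCovariant_affPOVM,
    fun s s' f f' hf hf' v v' hv hv' B hB => inner_packet hf.memLp hf'.memLp hv hv' hB,
    fun s N hN h0 => exists_perfect_packet s hN h0⟩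
  exact ⟨_, (isPacket_iff hf.memLp s _).2 rfl, fun v hv => (isPacket_iff hf.memLp s v).1 hv⟩
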